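/- Let $k$ be an algebraically closed field of characteristic $2$, let $E$ be a $k$-vector space of dimension $2m+1$ with $m\ge 1$, and let $(q_0,q_1)$ be a regular pair of quadratic forms on $E$, i.e. the scheme $X=V(q_0,q_1)$ of common zeros of $q_0$ and $q_1$ in the projective space $|E|\cong\mathbb P^{2m}$ of lines in $E$ is smooth over $k$ and of codimension $2$. A generator of $X$ is a projective linear subspace of $|E|$ that is contained in $X$ and has the maximal possible dimension among such subspaces. Let $\operatorname{Aut}(q_0,q_1)$ be the group of all $g\in\operatorname{GL}(E)$ with $q_0(gv)=q_0(v)$ and $q_1(gv)=q_1(v)$ for all $v\in E$; it acts on the set of generators of $X$ by $|L|\mapsto|g(L)|$. Then the generators of $X$ are exactly the $(m-1)$-dimensional projective linear subspaces contained in $X$, there are exactly $2^{2m}$ of them, and $\operatorname{Aut}(q_0,q_1)$ permutes them simply transitively: for any two generators $\Lambda,\Lambda'$ there is exactly one $g\in\operatorname{Aut}(q_0,q_1)$ with $g\Lambda=\Lambda'$. -/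

import Mathlib

/-!
Pairs `(q₀, q₁)` of quadratic forms on a finite-dimensional vector space `E`, the scheme
`X = V(q₀, q₁)` in the projective space of lines of `E`, its generators, and the group
`Aut(q₀, q₁)`.
-/

universe u v

namespace QuadricPair

open AlgebraicGeometry CategoryTheory

section Scheme

variable {k : Type u} [Field k] {E : Type v} [AddCommGroup E] [Module k E]

/-- The homogeneous polynomial of degree two which represents the quadratic form `q` in the
linear coordinates given by the basis `b`:
`∑ i, q(bᵢ) xᵢ² + ∑ i < j, (q(bᵢ + bⱼ) - q(bᵢ) - q(bⱼ)) xᵢ xⱼ`. -/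
noncomputable def toPoly {n : ℕ} (b : Module.Basis (Fin n) k E) (q : QuadraticForm k E) :
    MvPolynomial (Fin n) k :=
  ∑ i, MvPolynomial.C (q (b i)) * MvPolynomial.X i ^ 2 +
    ∑ i, ∑ j ∈ Finset.Ioi i,
      MvPolynomial.C (QuadraticMap.polar q (b i) (b j)) * MvPolynomial.X i * MvPolynomial.X j

/-- The coordinate ring `k[x₁, …, xₙ] / (q₀, q₁, xᵢ - 1)` of the standard affine open
subscheme `X ∩ {xᵢ ≠ 0}` of the closed subscheme `X = V(q₀, q₁)` of the projective space of
lines in `E`, with respect to the coordinates given by the basis `b`. -/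
abbrev ChartRing {n : ℕ} (b : Module.Basis (Fin n) k E) (q₀ q₁ : QuadraticForm k E)
    (i : Fin n) : Type u :=
  MvPolynomial (Fin n) k ⧸
    Ideal.span ({toPoly b q₀, toPoly b q₁, MvPolynomial.X i - 1} : Set (MvPolynomial (Fin n) k))

/-- The structure morphism `X ∩ {xᵢ ≠ 0} ⟶ Spec k`. -/
noncomputable def chart {n : ℕ} (b : Module.Basis (Fin n) k E) (q₀ q₁ : QuadraticForm k E)
    (i : Fin n) :
    Spec (CommRingCat.of (ChartRing b q₀ q₁ i)) ⟶ Spec (CommRingCat.of k) :=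
  Spec.map (CommRingCat.ofHom (algebraMap k (ChartRing b q₀ q₁ i)))

/-- The pair `(q₀, q₁)` is regular: the scheme `X = V(q₀, q₁)` is smooth over `k`, of
codimension `2` in the projective space of lines in `E`, which has dimension `dim E - 1`
(so that `X` is smooth over `k` of relative dimension `dim E - 3`; here `dim E ≥ 3`).
As smoothness is local on the source, it is stated on the standard affine open cover of `X`. -/
def IsRegular [FiniteDimensional k E] (q₀ q₁ : QuadraticForm k E) : Prop :=
  3 ≤ Module.finrank k E ∧
    ∀ i, SmoothOfRelativeDimension (Module.finrank k E - 3)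
      (chart (Module.finBasis k E) q₀ q₁ i)

end Scheme

section Generators

variable {k : Type u} [Field k] {E : Type v} [AddCommGroup E] [Module k E]

/-- The projective linear subspace `|L|` of lines in `L` is contained in `X = V(q₀, q₁)`:
the restrictions of both quadratic forms to `L` are zero. -/
def IsContained (q₀ q₁ : QuadraticForm k E) (L : Submodule k E) : Prop :=
  ∀ v ∈ L, q₀ v = 0 ∧ q₁ v = 0

/-- A generator of `X = V(q₀, q₁)` (over an algebraically closed field): a linear subspace of
`X` of maximal possible dimension. -/
def IsGenerator (q₀ q₁ : QuadraticForm k E) (L : Submodule k E) : Prop :=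
  IsContained q₀ q₁ L ∧
    ∀ L' : Submodule k E, IsContained q₀ q₁ L' → Module.finrank k L' ≤ Module.finrank k L

/-- The set of generators of `X = V(q₀, q₁)`. -/
def Generator (q₀ q₁ : QuadraticForm k E) : Type v :=
  {L : Submodule k E // IsGenerator q₀ q₁ L}

/-- `Aut(q₀, q₁)`: the subgroup of all `g` in `GL(E)` with `q₀(gv) = q₀(v)` and
`q₁(gv) = q₁(v)` for all `v` in `E`. -/
def Aut (q₀ q₁ : QuadraticForm k E) : Subgroup (E ≃ₗ[k] E) where
  carrier := {g | ∀ v, q₀ (g v) = q₀ v ∧ q₁ (g v) = q₁ v}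
  one_mem' := fun _ => ⟨rfl, rfl⟩
  mul_mem' := by
    intro g h hg hh v
    exact ⟨(hg.out (h v)).1.trans (hh.out v).1, (hg.out (h v)).2.trans (hh.out v).2⟩
  inv_mem' := by
    intro g hg v
    have h1 : g (g⁻¹ v) = v := g.apply_symm_apply v
    have h2 := hg.out (g⁻¹ v)
    rw [h1] at h2
    exact ⟨h2.1.symm, h2.2.symm⟩

theorem IsContained.map {q₀ q₁ : QuadraticForm k E} {L : Submodule k E}
    (hL : IsContained q₀ q₁ L) (g : Aut q₀ q₁) :
    IsContained q₀ q₁ (L.map (g : E ≃ₗ[k] E).toLinearMap) := by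
  rintro _ ⟨v, hv, rfl⟩
  exact ⟨(g.2.out v).1.trans (hL v hv).1, (g.2.out v).2.trans (hL v hv).2⟩

theorem IsGenerator.map {q₀ q₁ : QuadraticForm k E} {L : Submodule k E}
    (hL : IsGenerator q₀ q₁ L) (g : Aut q₀ q₁) :
    IsGenerator q₀ q₁ (L.map (g : E ≃ₗ[k] E).toLinearMap) := by
  refine ⟨hL.1.map g, fun L' hL' => ?_⟩
  rw [LinearEquiv.finrank_map_eq (g : E ≃ₗ[k] E) L]
  exact hL.2 L' hL'

/-- The action of `Aut(q₀, q₁)` on the set of generators: `g • |L| = |g(L)|`. -/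
instance (q₀ q₁ : QuadraticForm k E) : MulAction (Aut q₀ q₁) (Generator q₀ q₁) where
  smul g Λ := ⟨Λ.1.map (g : E ≃ₗ[k] E).toLinearMap, Λ.2.map g⟩
  one_smul Λ := Subtype.ext (Submodule.map_id Λ.1)
  mul_smul g h Λ := Subtype.ext
    (Submodule.map_comp (h : E ≃ₗ[k] E).toLinearMap (g : E ≃ₗ[k] E).toLinearMap Λ.1)

end Generators

end QuadricPair

/-! In characteristic 2 the polar forms `B₀`, `B₁` are alternating. Tangent vectors over the dual
numbers turn smoothness into the Jacobian criterion (`IsNonsingular`). As `dim E` is odd, every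
member of the pencil has an odd-dimensional radical. On it the quadratic form is the square of a
linear form, so a radical of dimension at least 3 would contain a singular point of `X`. Thus all
radicals are lines, and `(B₀, B₁)` is a single Kronecker block (`exists_isKroneckerBasis`). Its
vectors `vᵢ` span a space `V` of dimension `m + 1`, isotropic for both forms, which contains the
radical `r(t) = ∑ tⁱ vᵢ` of `B₀ - t B₁` for every `t`. Every `m`-dimensional `L` in `X` is a
complement of `V`.

Simple transitivity: an automorphism scales each `r(t)` by some `c` with `c² = 1`, so it fixes `V`
pointwise and moves other vectors by elements of `V^⊥ = V`. Hence it is determined by the image of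
one `L`. Conversely, the shear along `V` that carries `L` to `L'` preserves both forms.

Counting: such an `L` is spanned by vectors `uⱼ + ∑ H(j + i) vᵢ`, because isotropy is the Hankel
condition. The half-discriminant `f(t) = q₀(r(t)) + t q₁(r(t))` has derivative `q₁(r(t))`, so
nonsingularity makes it separable, with at least `2m` roots `tₐ`. Writing `H(p) = ∑ cₐ wₐ tₐᵖ` with
`wₐ = 1 / q₁(r(tₐ))` decouples the remaining equations into `2m` equations `cₐ² + cₐ + eₐ = 0`, each
with two solutions. -/

namespace QuadricPair

/-! ### Tangent spaces and the Jacobian criterion -/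

section Tangent

open AlgebraicGeometry CategoryTheory

variable {k : Type u} [Field k]

/-- A space of tangent vectors at a rational point of a standard smooth algebra of relative
dimension `n` has dimension at most `n`. -/
theorem finrank_le_of_isStandardSmoothOfRelativeDimension {A : Type u} [CommRing A] [Algebra k A]
    (n : ℕ) [Algebra.IsStandardSmoothOfRelativeDimension n k A] (φ : A →ₐ[k] k)
    {ι : Type} [Finite ι] (f : ι → A) (W : Submodule k (ι → k))
    (hW : ∀ w ∈ W, ∃ Φ : A →ₐ[k] DualNumber k, (∀ a, (Φ a).fst = φ a) ∧
      ∀ i, (Φ (f i)).snd = w i) :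
    Module.finrank k W ≤ n := by
  let _ : Module A k := Module.compHom k φ.toRingHom
  have hsm (a : A) (x : k) : a • x = φ a * x := rfl
  have : IsScalarTower k A k := ⟨fun c a x => by simp [hsm, mul_assoc]⟩
  have : SMulCommClass A k k := ⟨fun a c x => by simp only [hsm, smul_eq_mul]; ring⟩
  have : Nontrivial A := φ.toRingHom.domain_nontrivial
  have : Algebra.IsStandardSmooth k A :=
    Algebra.IsStandardSmoothOfRelativeDimension.isStandardSmooth n
  have hr : Module.finrank A (Ω[A⁄k]) = n := Module.finrank_eq_of_rank_eq
    (Algebra.IsStandardSmoothOfRelativeDimension.rank_kaehlerDifferential n)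
  let b : Module.Basis (Fin n) A (Ω[A⁄k]) :=
    Module.finBasisOfFinrankEq A (Ω[A⁄k]) hr
  let T : (Fin n → k) →ₗ[k] (ι → k) :=
    { toFun := fun c i => b.constr k c (KaehlerDifferential.D k A (f i))
      map_add' := fun c d => by ext i; simp
      map_smul' := fun c d => by ext i; simp }
  -- A tangent vector at `φ` is a derivation into `k`, hence a functional on the rank-`n` module of
  -- differentials.
  have hle : W ≤ LinearMap.range T := by
    intro w hw
    obtain ⟨Φ, h1, h2⟩ := hW w hw
    let D : Derivation k A k := Derivation.mk'
      { toFun := fun a => (Φ a).snd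
        map_add' := fun a a' => by simp
        map_smul' := fun c a => by simp }
      (fun a a' => by
        simp only [LinearMap.coe_mk, AddHom.coe_mk, map_mul, TrivSqZeroExt.snd_mul, h1, hsm,
          smul_eq_mul, MulOpposite.smul_eq_mul_unop, MulOpposite.unop_op]
        ring)
    refine ⟨fun j => D.liftKaehlerDifferential (b j), ?_⟩
    ext i
    have : b.constr k (fun j => D.liftKaehlerDifferential (b j)) = D.liftKaehlerDifferential :=
      b.ext fun j => by simp
    change b.constr k _ (KaehlerDifferential.D k A (f i)) = _
    rw [this, Derivation.liftKaehlerDifferential_comp_D]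
    exact h2 i
  calc Module.finrank k W ≤ Module.finrank k (LinearMap.range T) :=
        Submodule.finrank_mono hle
    _ ≤ Module.finrank k (Fin n → k) := LinearMap.finrank_range_le T
    _ = n := by simp

/-- A space of tangent vectors at a rational point of a smooth affine scheme of relative
dimension `n` has dimension at most `n`. -/
theorem finrank_le_of_smoothOfRelativeDimension {A : Type u} [CommRing A] [Algebra k A]
    (n : ℕ) (hA : SmoothOfRelativeDimension n
      (Spec.map (CommRingCat.ofHom (algebraMap k A)))) (φ : A →ₐ[k] k)
    {ι : Type} [Finite ι] (f : ι → A) (W : Submodule k (ι → k))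
    (hW : ∀ w ∈ W, ∃ Φ : A →ₐ[k] DualNumber k, (∀ a, (Φ a).fst = φ a) ∧
      ∀ i, (Φ (f i)).snd = w i) :
    Module.finrank k W ≤ n := by
  rw [HasRingHomProperty.Spec_iff (P := @SmoothOfRelativeDimension n)] at hA
  obtain ⟨s, hs, H⟩ := hA
  obtain ⟨g, hg, hφg⟩ : ∃ g ∈ s, φ g ≠ 0 := by
    by_contra! hcon
    have : Ideal.span s ≤ RingHom.ker φ := Ideal.span_le.2 hcon
    rw [hs, top_le_iff] at this
    exact RingHom.ker_ne_top φ this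
  have Hg := H g hg
  have e : (algebraMap A (Localization.Away g)).comp (algebraMap k A) =
    algebraMap k (Localization.Away g) := (IsScalarTower.algebraMap_eq k A _).symm
  have Hg' : (algebraMap k (Localization.Away g)).IsStandardSmoothOfRelativeDimension n := by
    rw [← e]; exact Hg
  rw [RingHom.isStandardSmoothOfRelativeDimension_algebraMap] at Hg'
  have hu : ∀ y : Submonoid.powers g, IsUnit (φ y) := by
    rintro ⟨_, i, rfl⟩
    simpa using (IsUnit.mk0 _ hφg).pow i
  refine finrank_le_of_isStandardSmoothOfRelativeDimension (A := Localization.Away g) n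
    (IsLocalization.liftAlgHom (M := Submonoid.powers g) (f := φ) hu)
    (fun i => algebraMap A _ (f i)) W fun w hw => ?_
  obtain ⟨Φ, h1, h2⟩ := hW w hw
  -- A dual number is a unit when its constant term is, so tangent vectors extend to the
  -- localization.
  have hu' : ∀ y : Submonoid.powers g, IsUnit (Φ y) := fun y => by
    rw [TrivSqZeroExt.isUnit_iff_isUnit_fst, h1]
    exact hu y
  refine ⟨IsLocalization.liftAlgHom (M := Submonoid.powers g) (f := Φ) hu', fun a => ?_,
    fun i => by simp [h2]⟩
  have : (TrivSqZeroExt.fstHom k k k).comp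
      (IsLocalization.liftAlgHom (M := Submonoid.powers g) (S := Localization.Away g)
        (f := Φ) hu') =
      IsLocalization.liftAlgHom (M := Submonoid.powers g) (f := φ) hu := by
    refine IsLocalization.algHom_ext (Submonoid.powers g) (AlgHom.ext fun a => ?_)
    have e1 := IsLocalization.lift_eq (S := Localization.Away g) (g := (Φ : A →+* DualNumber k))
      hu' a
    have e2 := IsLocalization.lift_eq (S := Localization.Away g) (g := (φ : A →+* k)) hu a
    exact (congrArg TrivSqZeroExt.fst e1).trans ((h1 a).trans e2.symm)
  exact DFunLike.congr_fun this a

variable {E : Type v} [AddCommGroup E] [Module k E]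

theorem apply_eq_sum_coords {n : ℕ} (b : Module.Basis (Fin n) k E) (q : QuadraticForm k E)
    (v : E) : q v = ∑ i, q (b i) * b.repr v i ^ 2 +
      ∑ i, ∑ j ∈ Finset.Ioi i, QuadraticMap.polar q (b i) (b j) * b.repr v i * b.repr v j := by
  classical
  conv_lhs => rw [← b.sum_repr v]
  have := DFunLike.congr_fun (q.toQuadraticMap_toBilin b) (∑ i, b.repr v i • b i)
  rw [← this]
  simp only [LinearMap.BilinMap.toQuadraticMap_apply, map_sum, LinearMap.sum_apply, map_smul,
    LinearMap.smul_apply, QuadraticMap.toBilin_apply, smul_eq_mul,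
    Finset.mul_sum]
  rw [← Finset.sum_add_distrib, Finset.sum_comm]
  refine Finset.sum_congr rfl fun i _ => ?_
  rw [← Finset.add_sum_erase _ _ (Finset.mem_univ i), if_pos rfl]
  congr 1
  · ring
  · rw [← Finset.sum_subset (s₁ := Finset.Ioi i)]
    · refine Finset.sum_congr rfl fun j hj => ?_
      have := Finset.mem_Ioi.1 hj
      rw [if_neg this.ne, if_pos this]; ring
    · intro j hj; simp [(Finset.mem_Ioi.1 hj).ne']
    · intro j hj hj'
      have h1 : j ≠ i := by simpa using hj
      have h2 : ¬ i < j := by simpa using hj'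
      rw [if_neg h1.symm, if_neg h2]; ring

theorem aeval_toPoly {n : ℕ} (b : Module.Basis (Fin n) k E) (q : QuadraticForm k E) (v : E) :
    MvPolynomial.aeval (b.repr v) (toPoly b q) = q v := by
  rw [apply_eq_sum_coords b q v]
  simp [toPoly]

theorem aeval_dualNumber_toPoly {n : ℕ} (b : Module.Basis (Fin n) k E) (q : QuadraticForm k E)
    (v w : E) :
    MvPolynomial.aeval (fun i => (TrivSqZeroExt.inl (b.repr v i) +
      TrivSqZeroExt.inr (b.repr w i) : DualNumber k)) (toPoly b q) =
      TrivSqZeroExt.inl (q v) + TrivSqZeroExt.inr (QuadraticMap.polar q v w) := by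
  have hpol : QuadraticMap.polar q v w =
      ∑ i, q (b i) * (2 * b.repr v i * b.repr w i) +
      ∑ i, ∑ j ∈ Finset.Ioi i, QuadraticMap.polar q (b i) (b j) *
        (b.repr v i * b.repr w j + b.repr w i * b.repr v j) := by
    rw [QuadraticMap.polar, apply_eq_sum_coords b q (v + w), apply_eq_sum_coords b q v,
      apply_eq_sum_coords b q w, sub_sub, add_add_add_comm, add_sub_add_comm]
    congr 1
    · rw [← Finset.sum_add_distrib, ← Finset.sum_sub_distrib]
      refine Finset.sum_congr rfl fun i _ => ?_
      simp only [map_add, Finsupp.add_apply]; ring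
    · rw [← Finset.sum_add_distrib, ← Finset.sum_sub_distrib]
      refine Finset.sum_congr rfl fun i _ => ?_
      rw [← Finset.sum_add_distrib, ← Finset.sum_sub_distrib]
      refine Finset.sum_congr rfl fun j _ => ?_
      simp only [map_add, Finsupp.add_apply]; ring
  ext
  · rw [← TrivSqZeroExt.fstHom_apply k, ← AlgHom.comp_apply, MvPolynomial.comp_aeval]
    simpa using aeval_toPoly b q v
  · simp only [toPoly, map_add, map_sum, map_mul, map_pow, MvPolynomial.aeval_X,
      MvPolynomial.algHom_C, TrivSqZeroExt.snd_add, TrivSqZeroExt.snd_sum,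
      TrivSqZeroExt.snd_inl, TrivSqZeroExt.snd_inr, hpol, zero_add, TrivSqZeroExt.algebraMap_eq_inl]
    congr 1
    · refine Finset.sum_congr rfl fun i _ => ?_
      simp only [sq, TrivSqZeroExt.snd_mul, TrivSqZeroExt.fst_mul, TrivSqZeroExt.fst_add,
        TrivSqZeroExt.snd_add, TrivSqZeroExt.fst_inl, TrivSqZeroExt.fst_inr,
        TrivSqZeroExt.snd_inl, TrivSqZeroExt.snd_inr, smul_eq_mul,
        MulOpposite.smul_eq_mul_unop, MulOpposite.unop_op]
      ring
    · refine Finset.sum_congr rfl fun i _ => Finset.sum_congr rfl fun j _ => ?_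
      simp only [TrivSqZeroExt.snd_mul, TrivSqZeroExt.fst_mul, TrivSqZeroExt.fst_add,
        TrivSqZeroExt.snd_add, TrivSqZeroExt.fst_inl, TrivSqZeroExt.fst_inr,
        TrivSqZeroExt.snd_inl, TrivSqZeroExt.snd_inr, smul_eq_mul,
        MulOpposite.smul_eq_mul_unop, MulOpposite.unop_op]
      ring

/-- The Jacobian criterion: at the points of `X` no nontrivial combination of the
differentials of `q₀` and `q₁` vanishes. -/
theorem IsRegular.exists_polar_ne_zero [FiniteDimensional k E] {q₀ q₁ : QuadraticForm k E}
    (hq : IsRegular q₀ q₁) {v : E} (hv : v ≠ 0) (h0 : q₀ v = 0) (h1 : q₁ v = 0) {s t : k}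
    (hst : s ≠ 0 ∨ t ≠ 0) :
    ∃ w, s * QuadraticMap.polar q₀ v w + t * QuadraticMap.polar q₁ v w ≠ 0 := by
  classical
  by_contra! hcon
  set b := Module.finBasis k E
  obtain ⟨i, hi⟩ : ∃ i, b.repr v i ≠ 0 := by
    by_contra! h
    exact hv (b.repr.map_eq_zero_iff.1 (Finsupp.ext h))
  wlog hvi : b.repr v i = 1 generalizing v
  · refine this (v := (b.repr v i)⁻¹ • v) (smul_ne_zero (inv_ne_zero hi) hv) ?_ ?_ ?_ ?_ ?_
    · rw [QuadraticMap.map_smul, h0, smul_zero]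
    · rw [QuadraticMap.map_smul, h1, smul_zero]
    · intro w
      rw [QuadraticMap.polar_smul_left, QuadraticMap.polar_smul_left, smul_eq_mul, smul_eq_mul]
      linear_combination (b.repr v i)⁻¹ * hcon w
    · simp [hi]
    · simp [hi]
  -- The two differentials are dependent, so one of them suffices. With the chart equation this
  -- leaves a tangent space of dimension at least `dim E - 2`, one too many.
  let ψ : E →ₗ[k] k × k := LinearMap.prod
    (if s ≠ 0 then QuadraticMap.polarBilin q₁ v else QuadraticMap.polarBilin q₀ v) (b.coord i)
  have hker : ∀ w ∈ LinearMap.ker ψ, QuadraticMap.polar q₀ v w = 0 ∧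
      QuadraticMap.polar q₁ v w = 0 ∧ b.repr w i = 0 := by
    intro w hw
    rw [LinearMap.mem_ker, LinearMap.prod_apply, Prod.ext_iff] at hw
    have h := hcon w
    by_cases hs : s = 0
    · have ht : t ≠ 0 := hst.resolve_left (not_not.2 hs)
      have hw1 : QuadraticMap.polar q₀ v w = 0 := by simpa [hs] using hw.1
      refine ⟨hw1, ?_, hw.2⟩
      simpa [hs, ht] using h
    · have hw1 : QuadraticMap.polar q₁ v w = 0 := by simpa [hs] using hw.1
      refine ⟨?_, hw1, hw.2⟩
      simpa [hs, hw1] using h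
  have hdim : Module.finrank k E ≤ Module.finrank k (LinearMap.ker ψ) + 2 := by
    have h := LinearMap.finrank_range_add_finrank_ker ψ
    have h' := Submodule.finrank_le (LinearMap.range ψ)
    simp at h'
    omega
  let φ : ChartRing b q₀ q₁ i →ₐ[k] k := Ideal.Quotient.liftₐ _ (MvPolynomial.aeval (b.repr v)) <| by
    intro a ha
    have : Ideal.span {toPoly b q₀, toPoly b q₁, MvPolynomial.X i - 1} ≤
        RingHom.ker (MvPolynomial.aeval (R := k) (b.repr v)) := by
      rw [Ideal.span_le]
      rintro _ (rfl | rfl | rfl)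
      · simpa [RingHom.mem_ker, aeval_toPoly] using h0
      · simpa [RingHom.mem_ker, aeval_toPoly] using h1
      · simp [RingHom.mem_ker, hvi]
    exact this ha
  have key := finrank_le_of_smoothOfRelativeDimension _ (hq.2 i) φ
    (fun j => Ideal.Quotient.mk _ (MvPolynomial.X j))
    ((LinearMap.ker ψ).map b.equivFun.toLinearMap) <| by
      rintro _ ⟨w, hw, rfl⟩
      obtain ⟨hw0, hw1, hwi⟩ := hker w hw
      let θ := MvPolynomial.aeval (R := k) (fun j => (TrivSqZeroExt.inl (b.repr v j) +
        TrivSqZeroExt.inr (b.repr w j) : DualNumber k))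
      refine ⟨Ideal.Quotient.liftₐ _ θ ?_, ?_, ?_⟩
      · intro a ha
        have : Ideal.span {toPoly b q₀, toPoly b q₁, MvPolynomial.X i - 1} ≤ RingHom.ker θ := by
          rw [Ideal.span_le]
          rintro _ (rfl | rfl | rfl)
          · change θ _ = 0
            rw [aeval_dualNumber_toPoly, h0, hw0]; simp
          · change θ _ = 0
            rw [aeval_dualNumber_toPoly, h1, hw1]; simp
          · simp [θ, RingHom.mem_ker, hvi, hwi]
        exact this ha
      · intro a
        obtain ⟨p, rfl⟩ := Ideal.Quotient.mk_surjective a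
        change (θ p).fst = MvPolynomial.aeval (b.repr v) p
        rw [← TrivSqZeroExt.fstHom_apply k, ← AlgHom.comp_apply, MvPolynomial.comp_aeval]
        simp
      · intro j
        change (θ (MvPolynomial.X j)).snd = _
        simp [θ]
  rw [LinearEquiv.finrank_map_eq] at key
  have := hq.1
  omega

end Tangent

/-! ### Alternating forms and radicals -/

section Pencil

open Module

variable {k : Type u} [Field k] {E : Type v} [AddCommGroup E] [Module k E]

theorem isotropic_sup_span {B : LinearMap.BilinForm k E} (hB : B.IsAlt) {L : Submodule k E}
    (hL : L ≤ B.orthogonal L) {x : E} (hx : x ∈ B.orthogonal L) :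
    L ⊔ k ∙ x ≤ B.orthogonal (L ⊔ k ∙ x) := by
  intro a ha b hb
  obtain ⟨l, hl, c, hc, rfl⟩ := Submodule.mem_sup.1 ha
  obtain ⟨l', hl', c', hc', rfl⟩ := Submodule.mem_sup.1 hb
  obtain ⟨r, rfl⟩ := Submodule.mem_span_singleton.1 hc
  obtain ⟨r', rfl⟩ := Submodule.mem_span_singleton.1 hc'
  have h1 : B l' l = 0 := hL hl l' hl'
  have h2 : B l' x = 0 := hx l' hl'
  have h3 : B x l = 0 := by rw [← hB.neg_eq, show B l x = 0 from hx l hl, neg_zero]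
  have h4 : B x x = 0 := hB x
  simp [h1, h2, h3, h4]

/-- The rank of an alternating bilinear form is even. -/
theorem even_finrank_add_finrank_ker [FiniteDimensional k E] {B : LinearMap.BilinForm k E}
    (hB : B.IsAlt) : Even (finrank k E + finrank k (LinearMap.ker B)) := by
  -- A maximal isotropic subspace is its own orthogonal and contains the radical, so the sum in
  -- question is `2 dim L`.
  obtain ⟨L, hL, hmax⟩ := WellFounded.has_min
    (IsWellFounded.wf (r := ((· > ·) : Submodule k E → Submodule k E → Prop)))
    {L | L ≤ B.orthogonal L} ⟨⊥, (bot_le : ⊥ ≤ B.orthogonal ⊥)⟩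
  have hLe : B.orthogonal L = L := by
    refine le_antisymm (fun x hx => ?_) hL
    by_contra hxL
    refine hmax (L ⊔ k ∙ x) (isotropic_sup_span hB hL hx)
      (lt_of_le_of_ne le_sup_left fun h => hxL ?_)
    rw [h]
    exact Submodule.mem_sup_right (Submodule.mem_span_singleton_self x)
  have hker : L ⊓ LinearMap.ker B = LinearMap.ker B := by
    refine inf_eq_right.2 fun x hx => ?_
    rw [← hLe]
    intro y _
    rw [← hB.neg_eq, LinearMap.mem_ker.1 hx]; simp
  have := LinearMap.BilinForm.finrank_add_finrank_orthogonal' (B := B) L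
  rw [hLe, hker] at this
  exact ⟨_, this.symm⟩

/-- A functional which vanishes on the radical is represented by a vector. -/
theorem exists_eq_of_vanish_on_ker [FiniteDimensional k E] {B : LinearMap.BilinForm k E}
    (hB : B.IsAlt) {φ : Dual k E} (hφ : ∀ x ∈ LinearMap.ker B, φ x = 0) : ∃ x, B x = φ := by
  have h1 : LinearMap.range B ≤ (LinearMap.ker B).dualAnnihilator := by
    rintro _ ⟨y, rfl⟩
    rw [Submodule.mem_dualAnnihilator]
    intro x hx
    rw [← hB.neg_eq, LinearMap.mem_ker.1 hx]; simp
  have h2 := LinearMap.finrank_range_add_finrank_ker B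
  have h3 : finrank k (LinearMap.ker B) + finrank k (LinearMap.ker B).dualAnnihilator =
      finrank k E := Subspace.finrank_add_finrank_dualAnnihilator_eq (LinearMap.ker B)
  have h4 := Submodule.eq_of_le_of_finrank_eq h1 (Nat.add_right_cancel (h2.trans (h3.symm.trans (add_comm _ _))))
  have : φ ∈ LinearMap.range B := by
    rw [h4]
    exact (Submodule.mem_dualAnnihilator φ).2 hφ
  exact this

/-- Over an algebraically closed field, every pencil of linear maps between spaces of the same
nonzero dimension contains a singular member. -/
theorem exists_singular_combination [IsAlgClosed k] {A C : Type*} [AddCommGroup A] [Module k A]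
    [AddCommGroup C] [Module k C] [FiniteDimensional k A] [FiniteDimensional k C]
    (hAC : finrank k C ≤ finrank k A) (hA : 0 < finrank k A) (f g : A →ₗ[k] C) :
    ∃ s t : k, (s ≠ 0 ∨ t ≠ 0) ∧ ∃ x, x ≠ 0 ∧ s • f x + t • g x = 0 := by
  by_cases hf : Function.Injective f
  · have := Module.nontrivial_of_finrank_pos hA
    let e := LinearEquiv.ofInjectiveOfFinrankEq f hf
      (le_antisymm (LinearMap.finrank_le_finrank_of_injective hf) hAC)
    have he (x : A) : e x = f x := rfl
    obtain ⟨c, hc⟩ := Module.End.exists_eigenvalue (e.symm.toLinearMap ∘ₗ g)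
    obtain ⟨x, hx⟩ := hc.exists_hasEigenvector
    refine ⟨-c, 1, Or.inr one_ne_zero, x, hx.2, ?_⟩
    have h' : g x = c • f x := by
      rw [← he, ← map_smul, ← hx.apply_eq_smul, LinearMap.comp_apply, LinearEquiv.coe_coe,
        LinearEquiv.apply_symm_apply]
    rw [h']; simp
  · rw [← LinearMap.ker_eq_bot, Submodule.eq_bot_iff] at hf
    push Not at hf
    obtain ⟨x, hx, hx0⟩ := hf
    exact ⟨1, 0, Or.inl one_ne_zero, x, hx0, by simp [LinearMap.mem_ker.1 hx]⟩

/-- Two consecutive members of a chain `B (x (j + 1)) = B' (x j)` are orthogonal, and so are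
all pairs of members. -/
theorem chain_isotropic {B B' : LinearMap.BilinForm k E} (hB : B.IsAlt) (hB' : B'.IsAlt)
    {x : ℕ → E} {N : ℕ} (hx : ∀ j < N, B (x (j + 1)) = B' (x j)) :
    ∀ a ≤ N, ∀ b ≤ N, B (x a) (x b) = 0 ∧ B' (x a) (x b) = 0 := by
  have main : ∀ d a, a + d ≤ N → B (x a) (x (a + d)) = 0 := by
    intro d
    induction d using Nat.strong_induction_on with
    | _ d ih =>
      intro a ha
      match d with
      | 0 => exact hB (x a)
      | 1 => rw [← hB.neg_eq, hx a (by omega), hB' (x a), neg_zero]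
      | d + 2 =>
        -- Both indices move inward by one, so the gap drops by two until it is 0 or 1.
        rw [← hB.neg_eq, ← add_assoc a (d + 1) 1, hx _ (by omega), hB'.neg_eq, ← hx a (by omega)]
        have := ih d (by omega) (a + 1) (by omega)
        rwa [add_right_comm] at this
  have hBz : ∀ a ≤ N, ∀ b ≤ N, B (x a) (x b) = 0 := by
    intro a ha b hb
    rcases le_total a b with h | h
    · obtain ⟨d, rfl⟩ := Nat.exists_eq_add_of_le h
      exact main d a hb
    · obtain ⟨d, rfl⟩ := Nat.exists_eq_add_of_le h
      rw [← hB.neg_eq, main d b ha, neg_zero]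
  refine fun a ha b hb => ⟨hBz a ha b hb, ?_⟩
  rcases ha.lt_or_eq with h | h
  · rw [← hx a h]; exact hBz _ h b hb
  · rcases hb.lt_or_eq with h' | h'
    · rw [← hB'.neg_eq, ← hx b h', hBz _ h' a ha, neg_zero]
    · rw [h, h']; exact hB' _

theorem exists_isotropic_of_one_lt_finrank [IsAlgClosed k] (q : QuadraticForm k E)
    (hE : 1 < finrank k E) : ∃ x, x ≠ 0 ∧ q x = 0 := by
  have := Module.nontrivial_of_finrank_pos (zero_lt_one.trans hE)
  obtain ⟨y, hy⟩ := exists_ne (0 : E)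
  by_cases hqy : q y = 0
  · exact ⟨y, hy, hqy⟩
  have : ∃ x, x ∉ k ∙ y := by
    by_contra! h
    have h1 : (k ∙ y) = ⊤ := eq_top_iff.2 fun x _ => h x
    have h2 := finrank_span_singleton (K := k) hy
    rw [h1, finrank_top] at h2
    omega
  obtain ⟨x, hx⟩ := this
  obtain ⟨c, hc⟩ := IsAlgClosed.exists_root (Polynomial.C (q y) * Polynomial.X ^ 2 +
    Polynomial.C (QuadraticMap.polar q x y) * Polynomial.X + Polynomial.C (q x))
    (by rw [Polynomial.degree_quadratic hqy]; decide)
  refine ⟨x + c • y, fun h => hx ?_, ?_⟩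
  · rw [eq_neg_of_add_eq_zero_left h]
    exact neg_mem (Submodule.smul_mem _ _ (Submodule.mem_span_singleton_self y))
  · rw [QuadraticMap.map_add q, QuadraticMap.map_smul, QuadraticMap.polar_smul_right]
    simp only [Polynomial.IsRoot.def, Polynomial.eval_add, Polynomial.eval_mul,
      Polynomial.eval_C, Polynomial.eval_pow, Polynomial.eval_X] at hc
    simp only [smul_eq_mul]
    linear_combination hc

theorem isAlt_polarBilin [CharP k 2] (q : QuadraticForm k E) : q.polarBilin.IsAlt := fun x => by
  change QuadraticMap.polar q x x = 0
  rw [QuadraticMap.polar_self, two_nsmul, CharTwo.add_self_eq_zero]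

/-- The radical of a member of a nonsingular pencil in odd dimension is a line. -/
theorem finrank_ker_polarBilin [IsAlgClosed k] [CharP k 2] [FiniteDimensional k E]
    (hE : Odd (finrank k E)) (q q' : QuadraticForm k E)
    (h : ∀ x ≠ 0, q x = 0 → q' x = 0 → ∃ w, QuadraticMap.polar q x w ≠ 0) :
    finrank k (LinearMap.ker q.polarBilin) = 1 := by
  have hpar := even_finrank_add_finrank_ker (isAlt_polarBilin q)
  by_contra hne
  have hodd : Odd (finrank k (LinearMap.ker q.polarBilin)) := by
    rw [Nat.even_add] at hpar
    rw [← Nat.not_even_iff_odd] at hE ⊢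
    tauto
  have h3 : 3 ≤ finrank k (LinearMap.ker q.polarBilin) := by
    obtain ⟨r, hr⟩ := hodd
    omega
  -- On the radical `q` is additive and scales by `c²`, so its square root is linear. The kernel has
  -- dimension at least 2, enough for a nonzero zero of `q'`.
  let ψ : LinearMap.ker q.polarBilin →ₗ[k] k :=
    { toFun := fun x => (frobeniusEquiv k 2).symm (q x)
      map_add' := fun x y => by
        have hxy : QuadraticMap.polar q x y = 0 :=
          DFunLike.congr_fun (LinearMap.mem_ker.1 x.2) (y : E)
        rw [Submodule.coe_add, QuadraticMap.map_add q, hxy, add_zero, map_add]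
      map_smul' := fun c x => by
        have : c * c = frobeniusEquiv k 2 c := by simp [frobenius_def, sq]
        rw [Submodule.coe_smul, QuadraticMap.map_smul, smul_eq_mul, map_mul, this,
          RingEquiv.symm_apply_apply, RingHom.id_apply, smul_eq_mul] }
  have hψ := LinearMap.finrank_range_add_finrank_ker ψ
  have hψ' := Submodule.finrank_le (LinearMap.range ψ)
  rw [finrank_self] at hψ'
  obtain ⟨x, hx0, hx⟩ := exists_isotropic_of_one_lt_finrank
    (q'.comp ((LinearMap.ker q.polarBilin).subtype ∘ₗ (LinearMap.ker ψ).subtype)) (by omega)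
  have hqx : q (x : LinearMap.ker q.polarBilin) = 0 := by
    have := LinearMap.mem_ker.1 x.2
    exact ((frobeniusEquiv k 2).symm.map_eq_zero_iff).1 this
  obtain ⟨w, hw⟩ := h ((x : LinearMap.ker q.polarBilin) : E) (by simpa using hx0) hqx hx
  exact hw (DFunLike.congr_fun (LinearMap.mem_ker.1 (x : LinearMap.ker q.polarBilin).2) w)

end Pencil

/-! ### Kronecker normal form of the pencil -/

section Chain

open Module

variable {k : Type u} [Field k] {E : Type v} [AddCommGroup E] [Module k E]

theorem exists_initial_relation {w : ℕ → E} {n : ℕ}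
    (hw : ¬ LinearIndependent k (fun i : Fin n => w i)) :
    ∃ l < n, ∃ c : ℕ → k, c l ≠ 0 ∧ ∑ i ∈ Finset.range (l + 1), c i • w i = 0 := by
  classical
  obtain ⟨g, hg, i, hi⟩ := Fintype.not_linearIndependent_iff.1 hw
  let c : ℕ → k := fun j => if h : j < n then g ⟨j, h⟩ else 0
  have hc : ∑ j ∈ Finset.range n, c j • w j = 0 := by
    rw [Finset.sum_range, ← hg]
    exact Finset.sum_congr rfl fun j _ => by simp [c]
  have hci : c i ≠ 0 := by simpa [c] using hi
  have hl := Nat.findGreatest_spec (P := fun j => c j ≠ 0) i.2.le hci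
  set l := Nat.findGreatest (fun j => c j ≠ 0) n
  have hln : l < n := by
    by_contra h
    exact hl (by simp [c, h])
  refine ⟨l, hln, c, hl, ?_⟩
  rw [← hc]
  refine Finset.sum_subset (fun j hj => ?_) fun j hj hj' => ?_
  · simp only [Finset.mem_range] at hj ⊢; omega
  · simp only [Finset.mem_range] at hj hj'
    have : ¬ c j ≠ 0 := Nat.findGreatest_is_greatest (P := fun j => c j ≠ 0) (n := n) (k := j) (by omega) hj.le
    rw [not_not.1 this, zero_smul]

variable {B B' : LinearMap.BilinForm k E}

/-- A linear relation between the members of a chain shortens it. -/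
theorem exists_chain_of_relation {w : ℕ → E} {l : ℕ} (h0 : w 0 ≠ 0) (hB0 : B (w 0) = 0)
    (hw : ∀ j < l, B (w (j + 1)) = B' (w j)) {c : ℕ → k} (hc : c l ≠ 0)
    (hsum : ∑ i ∈ Finset.range (l + 1), c i • w i = 0) :
    ∃ w' : ℕ → E, w' 0 ≠ 0 ∧ B (w' 0) = 0 ∧ (∀ j < l, B (w' (j + 1)) = B' (w' j)) ∧ w' l = 0 := by
  -- Coefficients of `∑ wⱼ Tʲ` times the reversed polynomial `∑ c_{l-p} Tᵖ`: the one at `0` is `c l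
  -- • w 0`, the one at `l` is the given relation.
  refine ⟨fun j => ∑ i ∈ Finset.range (j + 1), c (l - j + i) • w i, by simp [hc, h0],
    by simp [hB0], fun j hj => ?_, by simpa using hsum⟩
  simp only [map_sum, map_smul]
  rw [Finset.sum_range_succ', hB0, smul_zero, add_zero]
  refine Finset.sum_congr rfl fun i hi => ?_
  have hi' : i ≤ j := Nat.lt_succ_iff.1 (Finset.mem_range.1 hi)
  rw [hw i (by omega), show l - (j + 1) + (i + 1) = l - j + i by omega]

theorem mem_ker_of_finrank_eq_one {x : E} (hx : x ≠ 0) (hBx : B x = 0)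
    (h1 : finrank k (LinearMap.ker B) = 1) {y : E} (hy : B y = 0) : ∃ c : k, c • x = y := by
  obtain ⟨c, hc⟩ := (finrank_eq_one_iff_of_nonzero' (⟨x, hBx⟩ : LinearMap.ker B)
    (by simpa [Subtype.ext_iff] using hx)).1 h1 ⟨y, hy⟩
  exact ⟨c, congrArg Subtype.val hc⟩

/-- Starting in the radical line, the next vector always exists: by `chain_isotropic`, `B' (w j)`
vanishes on that line. A dependency then yields a chain ending in 0, and a shortest such chain is
independent. -/
theorem exists_linearIndependent_chain [FiniteDimensional k E] (hB : B.IsAlt) (hB' : B'.IsAlt)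
    (h1 : finrank k (LinearMap.ker B) = 1) :
    ∃ (n : ℕ) (w : ℕ → E), 0 < n ∧ B (w 0) = 0 ∧ (∀ j < n, B (w (j + 1)) = B' (w j)) ∧
      w n = 0 ∧ LinearIndependent k (fun i : Fin n => w i) := by
  classical
  have hex : ∃ n, ∃ w : ℕ → E, w 0 ≠ 0 ∧ B (w 0) = 0 ∧ (∀ j < n, B (w (j + 1)) = B' (w j)) ∧
      w n = 0 := by
    obtain ⟨x, hx⟩ := finrank_pos_iff_exists_ne_zero.1 (h1 ▸ zero_lt_one)
    have hx0 : (x : E) ≠ 0 := by simpa using hx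
    have hBx : B (x : E) = 0 := x.2
    have hS : ∀ φ : Dual k E, ∃ y, (∀ z ∈ LinearMap.ker B, φ z = 0) → B y = φ := fun φ => by
      by_cases h : ∀ z ∈ LinearMap.ker B, φ z = 0
      · obtain ⟨y, hy⟩ := exists_eq_of_vanish_on_ker hB h
        exact ⟨y, fun _ => hy⟩
      · exact ⟨0, fun h' => absurd h' h⟩
    choose S hS using hS
    let w : ℕ → E := fun j => (fun z => S (B' z))^[j] x
    have hw : ∀ N, ∀ j < N, B (w (j + 1)) = B' (w j) := by
      intro N
      induction N with
      | zero => intro j hj; omega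
      | succ N ih =>
        intro j hj
        rcases Nat.lt_succ_iff_lt_or_eq.1 hj with h | rfl
        · exact ih j h
        · simp only [w, Function.iterate_succ_apply']
          refine hS _ fun z hz => ?_
          obtain ⟨c, rfl⟩ := mem_ker_of_finrank_eq_one hx0 hBx h1 hz
          rw [map_smul]
          have := (chain_isotropic hB hB' ih j le_rfl 0 (Nat.zero_le _)).2
          exact (congrArg (c • ·) this).trans (smul_zero c)
    have hdep : ¬ LinearIndependent k (fun i : Fin (finrank k E + 1) => w i) := fun h => by
      have := h.fintype_card_le_finrank
      simp at this
    obtain ⟨l, -, c, hc, hsum⟩ := exists_initial_relation hdep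
    exact ⟨l, exists_chain_of_relation hx0 hBx (hw l) hc hsum⟩
  obtain ⟨w, h0, hB0, hw, hn⟩ := Nat.find_spec hex
  refine ⟨Nat.find hex, w, ?_, hB0, hw, hn, ?_⟩
  · rw [Nat.pos_iff_ne_zero]
    intro h
    rw [h] at hn
    exact h0 hn
  · by_contra hdep
    obtain ⟨l, hl, c, hc, hsum⟩ := exists_initial_relation hdep
    exact Nat.find_min hex hl
      (exists_chain_of_relation h0 hB0 (fun j hj => hw j (hj.trans hl)) hc hsum)

/-- If every nonzero member of an alternating pencil has a radical of dimension one, then the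
minimal chain spans a subspace of the largest possible dimension. -/
theorem chain_length [IsAlgClosed k] [FiniteDimensional k E] (hB : B.IsAlt) (hB' : B'.IsAlt)
    (hrad : ∀ s t : k, (s ≠ 0 ∨ t ≠ 0) → finrank k (LinearMap.ker (s • B + t • B')) = 1)
    {m n : ℕ} (hE : finrank k E = 2 * m + 1) {w : ℕ → E} (hn : 0 < n) (hB0 : B (w 0) = 0)
    (hw : ∀ j < n, B (w (j + 1)) = B' (w j)) (hwn : w n = 0)
    (hli : LinearIndependent k (fun i : Fin n => w i)) : n = m + 1 := by
  set V := Submodule.span k (Set.range fun i : Fin n => w i) with hV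
  have hdV : finrank k V = n := by rw [hV, finrank_span_eq_card hli, Fintype.card_fin]
  have hmem : ∀ j ≤ n, w j ∈ V := fun j hj => by
    rcases hj.lt_or_eq with h | rfl
    · exact Submodule.subset_span ⟨⟨j, h⟩, rfl⟩
    · rw [hwn]; exact zero_mem _
  have hker1 : finrank k (LinearMap.ker B) = 1 := by
    have h := hrad 1 0 (Or.inl one_ne_zero)
    rwa [one_smul, zero_smul, add_zero] at h
  have hw0 : w 0 ≠ 0 := hli.ne_zero ⟨0, hn⟩
  set P := B.orthogonal V with hP
  -- `B' (w i) = B (w (i + 1))`, and `w n = 0` keeps the shifted vector in `V` even for the last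
  -- index.
  have hVB' : ∀ x ∈ V, ∀ y ∈ P, B' x y = 0 := by
    intro x hx y hy
    induction hx using Submodule.span_induction with
    | mem x hx =>
      obtain ⟨i, rfl⟩ := hx
      change B' (w i) y = 0
      rw [← hw i i.2]
      exact hy _ (hmem _ i.2)
    | zero => simp
    | add a b _ _ ha hb => simp [ha, hb]
    | smul c a _ ha => simp [ha]
  have hVP : V ≤ P := by
    rw [hV, Submodule.span_le]
    rintro _ ⟨i, rfl⟩ y hy
    induction hy using Submodule.span_induction with
    | mem y hy =>
      obtain ⟨j, rfl⟩ := hy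
      exact (chain_isotropic hB hB' hw j j.2.le i i.2.le).1
    | zero => simp
    | add a b _ _ ha hb => simp [ha, hb]
    | smul c a _ ha => simp [ha]
  have hdP : finrank k P + n = 2 * m + 2 := by
    have h := LinearMap.BilinForm.finrank_add_finrank_orthogonal' (B := B) V
    have h' : V ⊓ LinearMap.ker B = LinearMap.ker B := by
      refine inf_eq_right.2 fun x hx => ?_
      obtain ⟨c, rfl⟩ := mem_ker_of_finrank_eq_one hw0 hB0 hker1 hx
      exact Submodule.smul_mem _ _ (hmem 0 hn.le)
    rw [h', hker1, hdV, hE, ← hP] at h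
    omega
  have hle := Submodule.finrank_mono hVP
  by_contra hne
  have hlt : n < m + 1 := by omega
  obtain ⟨V', hV'⟩ := V.exists_isCompl
  set C := V' ⊓ P with hC
  have hsup : V ⊔ C = P := by
    rw [hC, ← sup_inf_assoc_of_le V' hVP, hV'.sup_eq_top, top_inf_eq]
  have hinf : V ⊓ C = ⊥ := by
    rw [hC, ← inf_assoc, hV'.inf_eq_bot, bot_inf_eq]
  have hdC : 0 < finrank k C := by
    have := Submodule.finrank_sup_add_finrank_inf_eq V C
    rw [hsup, hinf, finrank_bot] at this
    omega
  -- If `n < m + 1`, then `P` exceeds `V`, and a singular member `D` on the complement `C` has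
  -- `D.orthogonal P` of dimension at least `n + 1`. Since `dim P = 2m + 2 - n`, the radical of `D`
  -- would have dimension at least 2.
  obtain ⟨s, t, hst, x, hx, hsx⟩ := exists_singular_combination
    (Subspace.dual_finrank_eq (K := k) (V := C)).le hdC (B.restrict C) (B'.restrict C)
  have hxP : (x : E) ∈ P := (Submodule.mem_inf.1 x.2).2
  set D := s • B + t • B' with hD
  have hVD : ∀ a ∈ V, ∀ y ∈ P, D a y = 0 := fun a ha y hy => by
    have h1 : B a y = 0 := hy a ha
    simp [hD, h1, hVB' a ha y hy]
  have hVD' : ∀ a ∈ V, ∀ y ∈ P, D y a = 0 := fun a ha y hy => by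
    have h1 : B y a = 0 := by rw [← hB.neg_eq, show B a y = 0 from hy a ha, neg_zero]
    have h2 : B' y a = 0 := by rw [← hB'.neg_eq, hVB' a ha y hy, neg_zero]
    simp [hD, h1, h2]
  have hCD : ∀ y ∈ C, D y x = 0 := fun y hy => by
    have h := DFunLike.congr_fun hsx ⟨y, hy⟩
    have h' : s * B x y + t * B' x y = 0 := h
    have h1 : B y x = - B x y := (hB.neg_eq _ _).symm
    have h2 : B' y x = - B' x y := (hB'.neg_eq _ _).symm
    simp only [hD, LinearMap.add_apply, LinearMap.smul_apply, smul_eq_mul, h1, h2]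
    linear_combination -h'
  have hVle : V < D.orthogonal P := by
    refine lt_of_le_of_ne (fun a ha y hy => hVD' a ha y hy) fun heq => hx ?_
    have hxD : (x : E) ∈ D.orthogonal P := by
      intro y hy
      rw [← hsup] at hy
      obtain ⟨a, ha, c, hc, rfl⟩ := Submodule.mem_sup.1 hy
      rw [map_add, LinearMap.add_apply, hVD a ha x hxP, hCD c hc, add_zero]
    rw [← heq] at hxD
    have : (x : E) ∈ V ⊓ C := ⟨hxD, x.2⟩
    rw [hinf, Submodule.mem_bot] at this
    exact Subtype.ext this
  have h1 := Submodule.finrank_lt_finrank_of_lt hVle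
  have h2 := LinearMap.BilinForm.finrank_add_finrank_orthogonal' (B := D) P
  have h3 : finrank k (P ⊓ LinearMap.ker D : Submodule k E) ≤ 1 := by
    rw [← hrad s t hst]
    exact Submodule.finrank_mono inf_le_right
  rw [hE] at h2
  omega

/-- Vectors `v₀, …, v_m, u₀, …, u_{m-1}` which bring the pair `B, B'` of alternating forms to the
Kronecker normal form. -/
structure IsKroneckerBasis (B B' : LinearMap.BilinForm k E) {m : ℕ} (v : Fin (m + 1) → E)
    (u : Fin m → E) : Prop where
  linearIndependent : LinearIndependent k v
  left_zero : B (v 0) = 0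
  left_succ : ∀ i : Fin m, B (v i.succ) = B' (v i.castSucc)
  right_last : B' (v (Fin.last m)) = 0
  left_vv : ∀ i j, B (v i) (v j) = 0
  right_vv : ∀ i j, B' (v i) (v j) = 0
  left_uu : ∀ i j, B (u i) (u j) = 0
  right_uu : ∀ i j, B' (u i) (u j) = 0
  left_uv : ∀ i j, B (u i) (v j) = if j = i.succ then 1 else 0
  right_uv : ∀ i j, B' (u i) (v j) = if j = i.castSucc then 1 else 0

/-- The `v` form the shortest chain. The `u` form a second chain with `B` and `B'` exchanged,
started at a vector that pairs under `B` to 1 with `v₁` and to 0 with the other `vᵢ`. It can be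
continued while `B (u j)` vanishes on the radical of `B'`, spanned by `v_m`. -/
theorem exists_isKroneckerBasis [IsAlgClosed k] [FiniteDimensional k E] (hB : B.IsAlt)
    (hB' : B'.IsAlt)
    (hrad : ∀ s t : k, (s ≠ 0 ∨ t ≠ 0) → finrank k (LinearMap.ker (s • B + t • B')) = 1)
    {m : ℕ} (hE : finrank k E = 2 * m + 1) :
    ∃ (v : Fin (m + 1) → E) (u : Fin m → E), IsKroneckerBasis B B' v u := by
  classical
  have hker1 : finrank k (LinearMap.ker B) = 1 := by
    have h := hrad 1 0 (Or.inl one_ne_zero)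
    rwa [one_smul, zero_smul, add_zero] at h
  have hker1' : finrank k (LinearMap.ker B') = 1 := by
    have h := hrad 0 1 (Or.inr one_ne_zero)
    rwa [one_smul, zero_smul, zero_add] at h
  obtain ⟨n, w, hn, hB0, hw, hwn, hli⟩ := exists_linearIndependent_chain hB hB' hker1
  obtain rfl := chain_length hB hB' hrad hE hn hB0 hw hwn hli
  have hiso := chain_isotropic hB hB' hw
  have hw0 : w 0 ≠ 0 := hli.ne_zero ⟨0, hn⟩
  have hwm : w m ≠ 0 := hli.ne_zero ⟨m, Nat.lt_succ_self m⟩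
  have hBm : B' (w m) = 0 := by rw [← hw m (Nat.lt_succ_self m), hwn, map_zero]
  have hdual : ∃ φ : Dual k E, ∀ i ≤ m, φ (w i) = if i = 1 then 1 else 0 := by
    obtain ⟨φ, hφ⟩ := LinearMap.exists_extend
      ((Basis.span hli).constr k fun i : Fin (m + 1) => if (i : ℕ) = 1 then (1 : k) else 0)
    refine ⟨φ, fun i hi => ?_⟩
    have h := DFunLike.congr_fun hφ ((Basis.span hli) ⟨i, Nat.lt_succ_of_le hi⟩)
    rw [Basis.constr_basis, LinearMap.comp_apply, Submodule.subtype_apply,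
      Basis.span_apply] at h
    exact h
  obtain ⟨φ, hφ⟩ := hdual
  obtain ⟨u₀, hu₀⟩ := exists_eq_of_vanish_on_ker hB (φ := φ) fun z hz => by
    obtain ⟨c, rfl⟩ := mem_ker_of_finrank_eq_one hw0 hB0 hker1 hz
    rw [map_smul, hφ 0 (Nat.zero_le _), if_neg zero_ne_one, smul_zero]
  have hS : ∀ φ : Dual k E, ∃ y, (∀ z ∈ LinearMap.ker B', φ z = 0) → B' y = φ := fun φ => by
    by_cases h : ∀ z ∈ LinearMap.ker B', φ z = 0
    · obtain ⟨y, hy⟩ := exists_eq_of_vanish_on_ker hB' h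
      exact ⟨y, fun _ => hy⟩
    · exact ⟨0, fun h' => absurd h' h⟩
  choose S hS using hS
  let x : ℕ → E := fun j => (fun z => S (B z))^[j] u₀
  have hx : ∀ j < m, (∀ i ≤ m, B (x j) (w i) = if i = j + 1 then 1 else 0) ∧
      ∀ l < j, B' (x (l + 1)) = B (x l) := by
    intro j
    induction j with
    | zero =>
      refine fun _ => ⟨fun i hi => ?_, fun l hl => absurd hl (Nat.not_lt_zero l)⟩
      change B u₀ (w i) = _
      rw [hu₀, hφ i hi]
    | succ j ih =>
      intro hj
      obtain ⟨ih1, ih2⟩ := ih (by omega)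
      have hstep : B' (x (j + 1)) = B (x j) := by
        simp only [x, Function.iterate_succ_apply']
        refine hS _ fun z hz => ?_
        obtain ⟨c, rfl⟩ := mem_ker_of_finrank_eq_one hwm hBm hker1' hz
        have := ih1 m le_rfl
        rw [if_neg (by omega)] at this
        rw [map_smul]
        exact (congrArg (c • ·) this).trans (smul_zero c)
      refine ⟨fun i hi => ?_, fun l hl => ?_⟩
      · rcases Nat.eq_zero_or_pos i with rfl | hi0
        · rw [← hB.neg_eq, hB0, LinearMap.zero_apply, neg_zero, if_neg (by omega)]
        · obtain ⟨i, rfl⟩ := Nat.exists_eq_add_of_lt hi0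
          rw [zero_add] at hi ⊢
          rw [← hB.neg_eq, hw i (by omega), hB'.neg_eq, hstep, ih1 i (by omega)]
          simp
      · rcases Nat.lt_succ_iff_lt_or_eq.1 hl with h | rfl
        · exact ih2 l h
        · exact hstep
  have hchain : ∀ l < m - 1, B' (x (l + 1)) = B (x l) := fun l hl =>
    (hx (m - 1) (by omega)).2 l hl
  have hiso' := chain_isotropic hB' hB hchain
  refine ⟨fun i => w i, fun j => x j, hli, hB0, fun i => hw i (by omega), hBm,
    fun i j => (hiso i i.2.le j j.2.le).1,
    fun i j => (hiso i i.2.le j j.2.le).2, fun i j => (hiso' i (by omega) j (by omega)).2,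
    fun i j => (hiso' i (by omega) j (by omega)).1, fun i j => ?_, fun i j => ?_⟩
  · rw [(hx i i.2).1 j (Nat.lt_succ_iff.1 j.2)]
    simp [Fin.ext_iff]
  · rw [← hB'.neg_eq, ← hw j j.2, hB.neg_eq]
    rcases (Nat.lt_succ_iff.1 j.2).lt_or_eq with h | h
    · rw [(hx i i.2).1 _ h]
      simp [Fin.ext_iff]
    · rw [h, hwn, map_zero, if_neg]
      intro h'
      have := congrArg Fin.val h'
      simp at this
      omega

end Chain

/-! ### Automorphisms and complements of the isotropic space -/

section Torsor

open Module

variable {k : Type u} [Field k] {E : Type v} [AddCommGroup E] [Module k E]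
  {q₀ q₁ : QuadraticForm k E}

/-- At no common zero of `q₀` and `q₁` does a nontrivial combination of their differentials
vanish. -/
def IsNonsingular (q₀ q₁ : QuadraticForm k E) : Prop :=
  ∀ x ≠ 0, q₀ x = 0 → q₁ x = 0 → ∀ s t : k, (s ≠ 0 ∨ t ≠ 0) →
    ∃ y, s * QuadraticMap.polar q₀ x y + t * QuadraticMap.polar q₁ x y ≠ 0

theorem IsNonsingular.eq_zero (h : IsNonsingular q₀ q₁) {x : E} (h0 : q₀ x = 0) (h1 : q₁ x = 0)
    {s t : k} (hst : s ≠ 0 ∨ t ≠ 0)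
    (hx : s • q₀.polarBilin x + t • q₁.polarBilin x = 0) : x = 0 := by
  by_contra hne
  obtain ⟨y, hy⟩ := h x hne h0 h1 s t hst
  exact hy (DFunLike.congr_fun hx y)

theorem IsNonsingular.finrank_ker [IsAlgClosed k] [CharP k 2] [FiniteDimensional k E]
    (h : IsNonsingular q₀ q₁) (hE : Odd (finrank k E)) {s t : k} (hst : s ≠ 0 ∨ t ≠ 0) :
    finrank k (LinearMap.ker (s • q₀.polarBilin + t • q₁.polarBilin)) = 1 := by
  have hpol (x y : E) : QuadraticMap.polar (s • q₀ + t • q₁ : QuadraticForm k E) x y =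
      s * QuadraticMap.polar q₀ x y + t * QuadraticMap.polar q₁ x y := by
    simp only [QuadraticMap.polar, add_apply, smul_apply, smul_eq_mul]
    ring
  have e : s • q₀.polarBilin + t • q₁.polarBilin =
      (s • q₀ + t • q₁ : QuadraticForm k E).polarBilin := by
    ext x y
    exact (hpol x y).symm
  rw [e]
  by_cases hs : s = 0
  · have ht : t ≠ 0 := hst.resolve_left (not_not.2 hs)
    refine finrank_ker_polarBilin hE _ q₀ fun x hx h1 h2 => ?_
    obtain ⟨y, hy⟩ := h x hx h2 (by simpa [hs, ht] using h1) s t hst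
    exact ⟨y, by rwa [hpol]⟩
  · refine finrank_ker_polarBilin hE _ q₁ fun x hx h1 h2 => ?_
    obtain ⟨y, hy⟩ := h x hx (by simpa [hs, h2] using h1) h2 s t hst
    exact ⟨y, by rwa [hpol]⟩

theorem IsContained.polar_eq_zero {L : Submodule k E} (hL : IsContained q₀ q₁ L) {x y : E}
    (hx : x ∈ L) (hy : y ∈ L) :
    QuadraticMap.polar q₀ x y = 0 ∧ QuadraticMap.polar q₁ x y = 0 := by
  have hxy := hL _ (add_mem hx hy)
  simp [QuadraticMap.polar, hxy, hL x hx, hL y hy]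

/-- `L` is isotropic for the polar form of `q₀` and, by nonsingularity, avoids its radical, so `2
dim L ≤ 2m + 1`. -/
theorem IsContained.finrank_le [FiniteDimensional k E] (h : IsNonsingular q₀ q₁) {m : ℕ}
    (hE : finrank k E = 2 * m + 1) {L : Submodule k E} (hL : IsContained q₀ q₁ L) :
    finrank k L ≤ m := by
  have h1 := LinearMap.BilinForm.finrank_add_finrank_orthogonal' (B := q₀.polarBilin) L
  have h2 : L ⊓ LinearMap.ker q₀.polarBilin = ⊥ := by
    refine (Submodule.eq_bot_iff _).2 fun x hx => ?_
    obtain ⟨hxL, hxk⟩ := Submodule.mem_inf.1 hx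
    refine h.eq_zero (hL x hxL).1 (hL x hxL).2 (Or.inl (one_ne_zero (α := k))) (t := 0) ?_
    rw [LinearMap.mem_ker.1 hxk, smul_zero, zero_smul, add_zero]
  have h3 : finrank k L ≤ finrank k (LinearMap.BilinForm.orthogonal q₀.polarBilin L) :=
    Submodule.finrank_mono fun x hx y hy => (hL.polar_eq_zero hy hx).1
  rw [h2, finrank_bot, hE] at h1
  omega

theorem polar_map_map (g : Aut q₀ q₁) (x y : E) :
    QuadraticMap.polar q₀ ((g : E ≃ₗ[k] E) x) ((g : E ≃ₗ[k] E) y) = QuadraticMap.polar q₀ x y ∧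
    QuadraticMap.polar q₁ ((g : E ≃ₗ[k] E) x) ((g : E ≃ₗ[k] E) y) =
      QuadraticMap.polar q₁ x y := by
  have h := g.2.out
  simp only [QuadraticMap.polar, ← map_add, (h _).1, (h _).2, and_self]

/-- The point `∑ tⁱ vᵢ` of the rational curve with coefficients `v`. -/
def ratVec {n : ℕ} (v : Fin n → E) (t : k) : E := ∑ i : Fin n, t ^ (i : ℕ) • v i

theorem eq_zero_of_forall_sum_pow_smul [Infinite k] {n : ℕ} {x : Fin n → E}
    (h : ∀ t : k, ratVec x t = 0) (i : Fin n) : x i = 0 := by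
  rw [← Module.forall_dual_apply_eq_zero_iff k]
  intro φ
  let f : Fin n → k := fun j => Infinite.natEmbedding k j
  have hf : Function.Injective f := fun a b hab =>
    Fin.ext ((Infinite.natEmbedding k).injective hab)
  have := Matrix.eq_zero_of_forall_index_sum_pow_mul_eq_zero (v := fun j => φ (x j)) hf
    fun j => by simpa [ratVec] using congrArg φ (h (f j))
  exact congrFun this i

namespace IsKroneckerBasis

variable {m : ℕ} {v : Fin (m + 1) → E} {u : Fin m → E}

theorem ratVec_mem_ker {B B' : LinearMap.BilinForm k E} (K : IsKroneckerBasis B B' v u) (t : k) :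
    B (ratVec v t) = t • B' (ratVec v t) := by
  simp only [ratVec, map_sum, map_smul]
  rw [Fin.sum_univ_succ, Fin.sum_univ_castSucc, K.left_zero, K.right_last, smul_zero, smul_zero,
    zero_add, add_zero, Finset.smul_sum]
  refine Finset.sum_congr rfl fun i _ => ?_
  rw [K.left_succ, smul_smul, Fin.val_succ, Fin.val_castSucc, pow_succ']

theorem ratVec_ne_zero {B B' : LinearMap.BilinForm k E} (K : IsKroneckerBasis B B' v u) (t : k) :
    ratVec v t ≠ 0 := fun h => by
  have := Fintype.linearIndependent_iff.1 K.linearIndependent _ h 0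
  simp at this

variable (K : IsKroneckerBasis q₀.polarBilin q₁.polarBilin v u)
include K

theorem polar_eq_zero_of_mem {x y : E} (hx : x ∈ Submodule.span k (Set.range v))
    (hy : y ∈ Submodule.span k (Set.range v)) :
    QuadraticMap.polar q₀ x y = 0 ∧ QuadraticMap.polar q₁ x y = 0 := by
  obtain ⟨c, rfl⟩ := (Submodule.mem_span_range_iff_exists_fun k).1 hx
  obtain ⟨d, rfl⟩ := (Submodule.mem_span_range_iff_exists_fun k).1 hy
  change q₀.polarBilin _ _ = 0 ∧ q₁.polarBilin _ _ = 0
  simp only [map_sum, map_smul, LinearMap.sum_apply, LinearMap.smul_apply, K.left_vv, K.right_vv,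
    smul_zero, Finset.sum_const_zero, and_self]

theorem finrank_span : finrank k (Submodule.span k (Set.range v)) = m + 1 := by
  rw [finrank_span_eq_card K.linearIndependent, Fintype.card_fin]

theorem mem_span_of_polar_eq_zero [IsAlgClosed k] [CharP k 2] [FiniteDimensional k E]
    (h : IsNonsingular q₀ q₁) (hE : finrank k E = 2 * m + 1) {x : E}
    (hx : ∀ y ∈ Submodule.span k (Set.range v), QuadraticMap.polar q₀ y x = 0) :
    x ∈ Submodule.span k (Set.range v) := by
  have h1 := LinearMap.BilinForm.finrank_add_finrank_orthogonal' (B := q₀.polarBilin)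
    (Submodule.span k (Set.range v))
  have h2 : finrank k (LinearMap.ker q₀.polarBilin) = 1 := by
    have := h.finrank_ker ⟨m, hE⟩ (Or.inl (one_ne_zero (α := k))) (t := 0)
    rwa [one_smul, zero_smul, add_zero] at this
  have h3 := Submodule.finrank_mono
    (inf_le_right : Submodule.span k (Set.range v) ⊓ LinearMap.ker q₀.polarBilin ≤ _)
  have hle : Submodule.span k (Set.range v) ≤
      LinearMap.BilinForm.orthogonal q₀.polarBilin (Submodule.span k (Set.range v)) :=
    fun y hy z hz => (K.polar_eq_zero_of_mem hz hy).1
  have h4 := Submodule.finrank_mono hle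
  have h5 := K.finrank_span
  rw [Submodule.eq_of_le_of_finrank_eq hle (by omega)]
  exact hx

/-- A subspace of `X` of dimension `m` is complementary to the span of `v`. -/
theorem isCompl [IsAlgClosed k] [FiniteDimensional k E]
    (h : IsNonsingular q₀ q₁) (hE : finrank k E = 2 * m + 1) {L : Submodule k E}
    (hL : IsContained q₀ q₁ L) (hLm : finrank k L = m) :
    IsCompl (Submodule.span k (Set.range v)) L := by
  have hV := K.finrank_span
  set V := Submodule.span k (Set.range v) with hVdef
  rw [Submodule.isCompl_iff_disjoint _ _ (by omega), disjoint_iff]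
  by_contra hne
  have hpos : 0 < finrank k (V ⊓ L : Submodule k E) := by
    rw [Nat.pos_iff_ne_zero]
    exact fun h0 => hne (Submodule.finrank_eq_zero.1 h0)
  -- Both polar forms map `V ⊓ L` into this annihilator of equal dimension. A singular combination
  -- gives a singular point of `X` in `L`.
  have hdim : finrank k (V ⊔ L).dualAnnihilator ≤ finrank k (V ⊓ L : Submodule k E) := by
    have h1 : finrank k (V ⊔ L : Submodule k E) + finrank k (V ⊔ L).dualAnnihilator =
      finrank k E := Subspace.finrank_add_finrank_dualAnnihilator_eq (V ⊔ L)
    have h2 := Submodule.finrank_sup_add_finrank_inf_eq V L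
    exact le_of_eq (by omega)
  have hmem (x : E) (hx : x ∈ V ⊓ L) : q₀.polarBilin x ∈ (V ⊔ L).dualAnnihilator ∧
      q₁.polarBilin x ∈ (V ⊔ L).dualAnnihilator := by
    simp only [Submodule.mem_dualAnnihilator]
    have key : ∀ y ∈ V ⊔ L, QuadraticMap.polar q₀ x y = 0 ∧ QuadraticMap.polar q₁ x y = 0 := by
      intro y hy
      obtain ⟨a, ha, l, hl, rfl⟩ := Submodule.mem_sup.1 hy
      have h1 := K.polar_eq_zero_of_mem hx.1 ha
      have h2 := hL.polar_eq_zero hx.2 hl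
      rw [QuadraticMap.polar_add_right, QuadraticMap.polar_add_right, h1.1, h1.2, h2.1, h2.2]
      simp
    exact ⟨fun y hy => (key y hy).1, fun y hy => (key y hy).2⟩
  obtain ⟨s, t, hst, x, hx, hsx⟩ := exists_singular_combination
    (A := (V ⊓ L : Submodule k E)) (C := (V ⊔ L).dualAnnihilator) hdim hpos
    ((q₀.polarBilin.domRestrict (V ⊓ L)).codRestrict _ fun x => (hmem x x.2).1)
    ((q₁.polarBilin.domRestrict (V ⊓ L)).codRestrict _ fun x => (hmem x x.2).2)
  refine hx (Subtype.ext (h.eq_zero (hL x x.2.2).1 (hL x x.2.2).2 hst ?_))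
  exact congrArg Subtype.val hsx

/-- Automorphisms fix the span of `v` pointwise. -/
theorem map_eq_self [IsAlgClosed k] [CharP k 2] [FiniteDimensional k E]
    (h : IsNonsingular q₀ q₁) (hE : finrank k E = 2 * m + 1) (g : Aut q₀ q₁) {x : E}
    (hx : x ∈ Submodule.span k (Set.range v)) : (g : E ≃ₗ[k] E) x = x := by
  have hinf : Infinite k := IsAlgClosed.instInfinite
  have hfix (t : k) : (g : E ≃ₗ[k] E) (ratVec v t) = ratVec v t := by
    have hne := K.ratVec_ne_zero t
    have hr := K.ratVec_mem_ker t
    set r := ratVec v t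
    have hD : ((1 : k) • q₀.polarBilin + (-t) • q₁.polarBilin) r = 0 := by
      rw [LinearMap.add_apply, LinearMap.smul_apply, LinearMap.smul_apply, hr, one_smul, neg_smul,
        add_neg_cancel]
    have hDg : ((1 : k) • q₀.polarBilin + (-t) • q₁.polarBilin) ((g : E ≃ₗ[k] E) r) = 0 := by
      ext y
      obtain ⟨z, rfl⟩ := (g : E ≃ₗ[k] E).surjective y
      have hz := DFunLike.congr_fun hD z
      simp only [LinearMap.add_apply, LinearMap.smul_apply, QuadraticMap.polarBilin_apply_apply,
        (polar_map_map g r z).1, (polar_map_map g r z).2] at hz ⊢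
      exact hz
    obtain ⟨c, hc⟩ := mem_ker_of_finrank_eq_one hne hD
      (h.finrank_ker ⟨m, hE⟩ (Or.inl one_ne_zero)) hDg
    -- A radical vector cannot lie on `X`, so preserving both forms forces `c² = 1`.
    have hq : q₀ r ≠ 0 ∨ q₁ r ≠ 0 := by
      by_contra! hcon
      refine hne (h.eq_zero hcon.1 hcon.2 (Or.inl (one_ne_zero (α := k))) (t := -t) ?_)
      exact hD
    have hc2 : c * c = 1 := by
      have h0 := (g.2.out r).1
      have h1 := (g.2.out r).2
      rw [← hc, QuadraticMap.map_smul, smul_eq_mul] at h0 h1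
      rcases hq with hq | hq
      · exact mul_right_cancel₀ hq (by rw [h0, one_mul])
      · exact mul_right_cancel₀ hq (by rw [h1, one_mul])
    have hc1 : c = 1 := by
      rcases mul_self_eq_one_iff.1 hc2 with h | h
      · exact h
      · rw [h, CharTwo.neg_eq]
    rw [← hc, hc1, one_smul]
  have hv (i) : (g : E ≃ₗ[k] E) (v i) = v i := by
    rw [← sub_eq_zero]
    refine eq_zero_of_forall_sum_pow_smul (k := k) (x := fun i => (g : E ≃ₗ[k] E) (v i) - v i)
      (fun t => ?_) i
    have := hfix t
    rw [ratVec, map_sum, ← sub_eq_zero, ← Finset.sum_sub_distrib] at this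
    rw [← this, ratVec]
    exact Finset.sum_congr rfl fun i _ => by rw [map_smul, smul_sub]
  obtain ⟨c, rfl⟩ := (Submodule.mem_span_range_iff_exists_fun k).1 hx
  simp only [map_sum, map_smul, hv]

/-- Automorphisms fix `V`, so `g x - x` is orthogonal to `V` and hence in `V`. On `L` the difference
of `g` and `g'` lies in `V ⊓ L' = 0`. -/
theorem aut_unique [IsAlgClosed k] [CharP k 2] [FiniteDimensional k E]
    (h : IsNonsingular q₀ q₁) (hE : finrank k E = 2 * m + 1) {L L' : Submodule k E}
    (hL : IsContained q₀ q₁ L) (hLm : finrank k L = m) (hL' : IsContained q₀ q₁ L')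
    (hLm' : finrank k L' = m) {g g' : Aut q₀ q₁}
    (hg : ∀ x ∈ L, (g : E ≃ₗ[k] E) x ∈ L') (hg' : ∀ x ∈ L, (g' : E ≃ₗ[k] E) x ∈ L') :
    g = g' := by
  have hsub (f : Aut q₀ q₁) (x : E) :
      (f : E ≃ₗ[k] E) x - x ∈ Submodule.span k (Set.range v) := by
    refine K.mem_span_of_polar_eq_zero h hE fun y hy => ?_
    have := (polar_map_map f y x).1
    rw [K.map_eq_self h hE f hy] at this
    rw [QuadraticMap.polar_sub_right, this, sub_self]
  refine Subtype.ext (LinearEquiv.ext fun x => ?_)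
  have hx : x ∈ Submodule.span k (Set.range v) ⊔ L := by
    rw [(K.isCompl h hE hL hLm).sup_eq_top]; trivial
  obtain ⟨a, ha, l, hl, rfl⟩ := Submodule.mem_sup.1 hx
  rw [map_add, map_add, K.map_eq_self h hE g ha, K.map_eq_self h hE g' ha, add_right_inj,
    ← sub_eq_zero]
  have hV := sub_mem (hsub g l) (hsub g' l)
  rw [sub_sub_sub_cancel_right] at hV
  have := (K.isCompl h hE hL' hLm').disjoint.le_bot ⟨hV, sub_mem (hg l hl) (hg' l hl)⟩
  exact this

theorem exists_aut [IsAlgClosed k] [CharP k 2] [FiniteDimensional k E]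
    (h : IsNonsingular q₀ q₁) (hE : finrank k E = 2 * m + 1) {L L' : Submodule k E}
    (hL : IsContained q₀ q₁ L) (hLm : finrank k L = m) (hL' : IsContained q₀ q₁ L')
    (hLm' : finrank k L' = m) :
    ∃ g : Aut q₀ q₁, ∀ x ∈ L, (g : E ≃ₗ[k] E) x ∈ L' := by
  have hc := K.isCompl h hE hL hLm
  have hc' := K.isCompl h hE hL' hLm'
  have hVV := fun x y => K.polar_eq_zero_of_mem (x := x) (y := y)
  set V := Submodule.span k (Set.range v)
  -- The shear `1 + N`, where `N` maps into `V` and kills `V`. So `N² = 0`, and in characteristic 2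
  -- `G` is an involution.
  let G : E →ₗ[k] E := LinearMap.id - V.projection L' hc' + V.projection L hc
  have hGV : ∀ a ∈ V, G a = a := fun a ha => by
    simp [G, Submodule.projection_apply_of_mem_left _ ha]
  have hGL : ∀ l ∈ L, G l = l - V.projection L' hc' l := fun l hl => by
    simp [G, (Submodule.projection_apply_eq_zero_iff hc).2 hl]
  have hGL' : ∀ l ∈ L, G l ∈ L' := fun l hl => by
    rw [hGL l hl]; exact Submodule.sub_projection_mem hc' l
  have hinv : Function.Involutive G := fun x => by
    have hN : G x = x + (V.projection L hc x - V.projection L' hc' x) := by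
      simp [G]; abel
    have hNV : V.projection L hc x - V.projection L' hc' x ∈ V :=
      sub_mem (Submodule.projection_apply_mem _ _) (Submodule.projection_apply_mem _ _)
    set n := V.projection L hc x - V.projection L' hc' x
    have h2 : n + n = 0 := by
      rw [← two_smul k n, CharTwo.two_eq_zero, zero_smul]
    rw [hN, map_add, hGV n hNV, hN, add_assoc, h2, add_zero]
  refine ⟨⟨LinearEquiv.ofInvolutive G hinv, fun x => ?_⟩, hGL'⟩
  change q₀ (G x) = q₀ x ∧ q₁ (G x) = q₁ x
  have hx : x ∈ V ⊔ L := by rw [hc.sup_eq_top]; trivial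
  obtain ⟨a, ha, l, hl, rfl⟩ := Submodule.mem_sup.1 hx
  have hpV : V.projection L' hc' l ∈ V := Submodule.projection_apply_mem _ _
  have hz := hVV _ _ ha hpV
  have h1 := hL' _ (hGL' l hl)
  rw [map_add, hGV a ha, QuadraticMap.map_add q₀, QuadraticMap.map_add q₁,
    QuadraticMap.map_add q₀ a l, QuadraticMap.map_add q₁ a l, h1.1, h1.2, (hL l hl).1,
    (hL l hl).2, hGL l hl, QuadraticMap.polar_sub_right, QuadraticMap.polar_sub_right, hz.1, hz.2,
    sub_zero, sub_zero]
  exact ⟨rfl, rfl⟩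

end IsKroneckerBasis

end Torsor

/-! ### Hankel matrices and the half-discriminant -/

section Count

open Module

/-- A family with the symmetries of a Hankel matrix is a Hankel matrix. -/
theorem exists_hankel {R : Type*} {m : ℕ} {N : ℕ → ℕ → R} (h1 : ∀ i < m, ∀ j < m, N i j = N j i)
    (h0 : ∀ i < m, ∀ j < m, N i (j + 1) = N j (i + 1)) :
    ∃ H : ℕ → R, ∀ i < m, ∀ j ≤ m, N i j = H (i + j) := by
  -- Read along the top row, then down the last column.
  refine ⟨fun p => if p ≤ m then N 0 p else N (p - m) m, fun i => ?_⟩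
  induction i with
  | zero => intro _ j hj; simp [hj]
  | succ i ih =>
    intro hi j hj
    rcases hj.lt_or_eq with h | rfl
    · rw [h1 _ hi _ h, ← h0 i (by omega) j h, ih (by omega) (j + 1) h,
        show i + (j + 1) = i + 1 + j by omega]
    · change N (i + 1) j = if i + 1 + j ≤ j then _ else N (i + 1 + j - j) j
      rw [if_neg (by omega), Nat.add_sub_cancel]

variable {k : Type u} [Field k]

theorem natCard_artinSchreier [IsAlgClosed k] [CharP k 2] {ι : Type} [Fintype ι] (e : ι → k) :
    Nat.card {c : ι → k // ∀ a, c a ^ 2 + c a + e a = 0} = 2 ^ Fintype.card ι := by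
  have h (a : ι) : Nat.card {x : k // x ^ 2 + x + e a = 0} = 2 := by
    obtain ⟨z, hz⟩ := IsAlgClosed.exists_root (Polynomial.C (1 : k) * Polynomial.X ^ 2 +
      Polynomial.C 1 * Polynomial.X + Polynomial.C (e a))
      (by rw [Polynomial.degree_quadratic one_ne_zero]; decide)
    have hz' : z ^ 2 + z + e a = 0 := by simpa using hz
    have hset : {x : k | x ^ 2 + x + e a = 0} = {z, z + 1} := by
      ext x
      have h2 : (2 : k) = 0 := CharTwo.two_eq_zero
      simp only [Set.mem_ofPred_eq, Set.mem_insert_iff, Set.mem_singleton_iff]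
      have : x ^ 2 + x + e a = (x - z) * (x - (z + 1)) := by
        linear_combination hz' + h2 * (x - z ^ 2 - z + x * z)
      rw [this, mul_eq_zero, sub_eq_zero, sub_eq_zero]
    have := Set.ncard_pair (a := z) (b := z + 1) (by simp)
    rw [← hset] at this
    exact this
  rw [Nat.card_congr (Equiv.subtypePiEquivPi (p := fun a (x : k) => x ^ 2 + x + e a = 0)),
    Nat.card_pi, Finset.prod_congr rfl fun a _ => h a, Finset.prod_const, Finset.card_univ]

variable {E : Type v} [AddCommGroup E] [Module k E]

theorem map_sum_of_polar_eq_zero (q : QuadraticForm k E) {ι : Type*} (s : Finset ι) (x : ι → E)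
    (h : ∀ i j, QuadraticMap.polar q (x i) (x j) = 0) (c : ι → k) :
    q (∑ i ∈ s, c i • x i) = ∑ i ∈ s, c i ^ 2 * q (x i) := by
  classical
  induction s using Finset.induction_on with
  | empty => simp
  | insert a s ha ih =>
    have hp : QuadraticMap.polar q (c a • x a) (∑ i ∈ s, c i • x i) = 0 := by
      change q.polarBilin _ _ = 0
      rw [map_sum]
      refine Finset.sum_eq_zero fun i _ => ?_
      simp [h]
    rw [Finset.sum_insert ha, Finset.sum_insert ha, QuadraticMap.map_add q, hp, ih,
      QuadraticMap.map_smul, smul_eq_mul, add_zero, sq]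

theorem isContained_span {q₀ q₁ : QuadraticForm k E} {n : ℕ} {y : Fin n → E}
    (h : ∀ i, q₀ (y i) = 0 ∧ q₁ (y i) = 0)
    (hp : ∀ i j, QuadraticMap.polar q₀ (y i) (y j) = 0 ∧ QuadraticMap.polar q₁ (y i) (y j) = 0) :
    IsContained q₀ q₁ (Submodule.span k (Set.range y)) := by
  intro x hx
  obtain ⟨c, rfl⟩ := (Submodule.mem_span_range_iff_exists_fun k).1 hx
  rw [map_sum_of_polar_eq_zero q₀ _ _ fun i j => (hp i j).1,
    map_sum_of_polar_eq_zero q₁ _ _ fun i j => (hp i j).2]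
  simp [h]

open Polynomial in
/-- The half-discriminant of the pencil. -/
noncomputable def halfDisc (q₀ q₁ : QuadraticForm k E) {n : ℕ} (v : Fin n → E) : k[X] :=
  ∑ i : Fin n, (C (q₀ (v i)) * X ^ (2 * (i : ℕ)) + C (q₁ (v i)) * X ^ (2 * (i : ℕ) + 1))

namespace IsKroneckerBasis

variable {q₀ q₁ : QuadraticForm k E} {m : ℕ} {v : Fin (m + 1) → E} {u : Fin m → E}
  (K : IsKroneckerBasis q₀.polarBilin q₁.polarBilin v u)
include K

theorem map_ratVec (t : k) :
    q₀ (ratVec v t) = ∑ i : Fin (m + 1), t ^ (2 * (i : ℕ)) * q₀ (v i) ∧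
    q₁ (ratVec v t) = ∑ i : Fin (m + 1), t ^ (2 * (i : ℕ)) * q₁ (v i) := by
  rw [ratVec, map_sum_of_polar_eq_zero q₀ _ _ K.left_vv, map_sum_of_polar_eq_zero q₁ _ _ K.right_vv]
  simp only [← pow_mul, mul_comm, and_self]

theorem eval_halfDisc (t : k) :
    (halfDisc q₀ q₁ v).eval t = q₀ (ratVec v t) + t * q₁ (ratVec v t) := by
  rw [(K.map_ratVec t).1, (K.map_ratVec t).2, Finset.mul_sum, ← Finset.sum_add_distrib, halfDisc,
    Polynomial.eval_finsetSum]
  refine Finset.sum_congr rfl fun i _ => ?_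
  simp only [Polynomial.eval_add, Polynomial.eval_mul, Polynomial.eval_C, Polynomial.eval_pow,
    Polynomial.eval_X]
  ring

/-- In characteristic 2 only the odd powers, which carry the values of `q₁`, survive
differentiation. -/
theorem eval_derivative_halfDisc [CharP k 2] (t : k) :
    (halfDisc q₀ q₁ v).derivative.eval t = q₁ (ratVec v t) := by
  rw [(K.map_ratVec t).2, halfDisc, Polynomial.derivative_sum, Polynomial.eval_finsetSum]
  refine Finset.sum_congr rfl fun i _ => ?_
  have h2 : ((2 * (i : ℕ) : ℕ) : k) = 0 := by
    rw [Nat.cast_mul, Nat.cast_two, CharTwo.two_eq_zero, zero_mul]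
  rw [Polynomial.derivative_add, Polynomial.derivative_C_mul_X_pow,
    Polynomial.derivative_C_mul_X_pow, Nat.cast_succ, h2, mul_zero, Polynomial.C_0,
    zero_mul, zero_add, zero_add, mul_one, Nat.add_sub_cancel, Polynomial.eval_mul,
    Polynomial.eval_C, Polynomial.eval_pow, Polynomial.eval_X, mul_comm]

theorem map_ratVec_ne_zero (h : IsNonsingular q₀ q₁) (t : k)
    (h0 : q₀ (ratVec v t) + t * q₁ (ratVec v t) = 0) : q₁ (ratVec v t) ≠ 0 := fun h1 => by
  rw [h1, mul_zero, add_zero] at h0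
  refine K.ratVec_ne_zero t (h.eq_zero h0 h1 (Or.inl (one_ne_zero (α := k))) (t := -t) ?_)
  rw [K.ratVec_mem_ker t, one_smul, ← add_smul, add_neg_cancel, zero_smul]

/-- The coefficients at `2m` and `2m + 1` are the values of `q₀` and `q₁` at `v_m`. This vector
spans the radical at infinity, so they are not both zero. -/
theorem le_natDegree_halfDisc (h : IsNonsingular q₀ q₁) :
    2 * m ≤ (halfDisc q₀ q₁ v).natDegree := by
  have hne : q₀ (v (Fin.last m)) ≠ 0 ∨ q₁ (v (Fin.last m)) ≠ 0 := by
    by_contra! hcon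
    refine K.linearIndependent.ne_zero (Fin.last m)
      (h.eq_zero hcon.1 hcon.2 (Or.inr (one_ne_zero (α := k))) (s := 0) ?_)
    rw [K.right_last, smul_zero, zero_smul, add_zero]
  rcases hne with hne | hne
  · refine Polynomial.le_natDegree_of_ne_zero ?_
    rw [halfDisc, Polynomial.finsetSum_coeff, Finset.sum_eq_single (Fin.last m)]
    · simpa [Polynomial.coeff_X_pow] using hne
    · intro i _ hi
      have : (i : ℕ) ≠ m := fun h' => hi (Fin.ext h')
      simp only [Polynomial.coeff_add, Polynomial.coeff_C_mul, Polynomial.coeff_X_pow]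
      rw [if_neg (by omega), if_neg (by omega)]; simp
    · simp
  · refine (Nat.le_succ _).trans (Polynomial.le_natDegree_of_ne_zero (n := 2 * m + 1) ?_)
    rw [halfDisc, Polynomial.finsetSum_coeff, Finset.sum_eq_single (Fin.last m)]
    · simpa [Polynomial.coeff_X_pow] using hne
    · intro i _ hi
      have : (i : ℕ) ≠ m := fun h' => hi (Fin.ext h')
      simp only [Polynomial.coeff_add, Polynomial.coeff_C_mul, Polynomial.coeff_X_pow]
      rw [if_neg (by omega), if_neg (by omega)]; simp
    · simp

/-- At a multiple root, `q₁(r(t))`, the derivative, would vanish too. Only `2m` roots are kept, one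
for each entry `H(0), …, H(2m - 1)`, even if the degree is `2m + 1`. -/
theorem exists_roots [IsAlgClosed k] [CharP k 2] (h : IsNonsingular q₀ q₁) :
    ∃ t : Fin (2 * m) → k, Function.Injective t ∧
      ∀ a, q₀ (ratVec v (t a)) + t a * q₁ (ratVec v (t a)) = 0 := by
  classical
  rcases Nat.eq_zero_or_pos m with rfl | hm
  · exact ⟨fun _ => 0, fun a => absurd a.2 (by simp), fun a => absurd a.2 (by simp)⟩
  have hdeg := K.le_natDegree_halfDisc h
  have hne : halfDisc q₀ q₁ v ≠ 0 := by
    rintro h0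
    rw [h0, Polynomial.natDegree_zero] at hdeg
    omega
  have hroot : ∀ t, (halfDisc q₀ q₁ v).IsRoot t →
      q₀ (ratVec v t) + t * q₁ (ratVec v t) = 0 := fun t ht => by
    rw [← K.eval_halfDisc t]; exact ht
  have hnodup : (halfDisc q₀ q₁ v).roots.Nodup := by
    rw [Multiset.nodup_iff_count_le_one]
    intro t
    rw [Polynomial.count_roots]
    by_contra! hlt
    obtain ⟨h1, h2⟩ := (Polynomial.one_lt_rootMultiplicity_iff_isRoot hne).1 hlt
    rw [Polynomial.IsRoot.def, K.eval_derivative_halfDisc t] at h2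
    exact K.map_ratVec_ne_zero h t (hroot t h1) h2
  have hcard : 2 * m ≤ (halfDisc q₀ q₁ v).roots.toFinset.card := by
    rw [Multiset.toFinset_card_of_nodup hnodup,
      Polynomial.splits_iff_card_roots.1 (IsAlgClosed.splits _)]
    exact hdeg
  obtain ⟨s, hs, hsc⟩ := Finset.exists_subset_card_eq hcard
  refine ⟨fun a => (s.equivFinOfCardEq hsc).symm a,
    Subtype.val_injective.comp (s.equivFinOfCardEq hsc).symm.injective, fun a => hroot _ ?_⟩
  have := hs ((s.equivFinOfCardEq hsc).symm a).2
  rw [Multiset.mem_toFinset] at this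
  exact Polynomial.isRoot_of_mem_roots this

/-- Pairing with `vᵢ` under the polar form of `q₁` reads off `d i`, as `V` is isotropic. -/
theorem coeff_eq_zero {x : Fin m → E} (hx : ∀ j, x j ∈ Submodule.span k (Set.range v))
    {d : Fin m → k} (hd : ∑ j, d j • (u j + x j) ∈ Submodule.span k (Set.range v)) (i : Fin m) :
    d i = 0 := by
  have h1 : q₁.polarBilin (∑ j, d j • (u j + x j)) (v i.castSucc) = 0 :=
    (K.polar_eq_zero_of_mem hd (Submodule.subset_span ⟨_, rfl⟩)).2
  have h2 (j : Fin m) : q₁.polarBilin (x j) (v i.castSucc) = 0 :=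
    (K.polar_eq_zero_of_mem (hx j) (Submodule.subset_span ⟨_, rfl⟩)).2
  simpa [-QuadraticMap.polarBilin_apply_apply, h2, K.right_uv] using h1

theorem finrank_span_add {x : Fin m → E} (hx : ∀ j, x j ∈ Submodule.span k (Set.range v)) :
    finrank k (Submodule.span k (Set.range fun j => u j + x j)) = m := by
  rw [finrank_span_eq_card, Fintype.card_fin]
  refine Fintype.linearIndependent_iff.2 fun d hd => K.coeff_eq_zero hx ?_
  rw [hd]
  exact zero_mem _

theorem polar_u_sum (i : Fin m) (c : Fin (m + 1) → k) :
    QuadraticMap.polar q₀ (u i) (∑ j, c j • v j) = c i.succ ∧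
    QuadraticMap.polar q₁ (u i) (∑ j, c j • v j) = c i.castSucc := by
  change q₀.polarBilin _ _ = _ ∧ q₁.polarBilin _ _ = _
  simp only [map_sum, map_smul, K.left_uv, K.right_uv, smul_eq_mul, mul_ite, mul_one, mul_zero,
    Finset.sum_ite_eq', Finset.mem_univ, if_true, and_self]

theorem polar_add_add (c : Fin m → Fin (m + 1) → k) (i j : Fin m) :
    QuadraticMap.polar q₀ (u i + ∑ l, c i l • v l) (u j + ∑ l, c j l • v l) =
      c j i.succ + c i j.succ ∧
    QuadraticMap.polar q₁ (u i + ∑ l, c i l • v l) (u j + ∑ l, c j l • v l) =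
      c j i.castSucc + c i j.castSucc := by
  have hV (i) : ∑ l, c i l • v l ∈ Submodule.span k (Set.range v) :=
    (Submodule.mem_span_range_iff_exists_fun k).2 ⟨c i, rfl⟩
  have h1 := K.polar_u_sum i (c j)
  have h2 := K.polar_u_sum j (c i)
  rw [QuadraticMap.polar_comm q₀, QuadraticMap.polar_comm q₁] at h2
  have h3 := K.polar_eq_zero_of_mem (hV i) (hV j)
  have h4 : QuadraticMap.polar q₀ (u i) (u j) = 0 := K.left_uu i j
  have h5 : QuadraticMap.polar q₁ (u i) (u j) = 0 := K.right_uu i j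
  simp only [QuadraticMap.polar_add_left, QuadraticMap.polar_add_right, h1, h3, h4, h5,
    h2, zero_add, add_zero]
  exact ⟨add_comm _ _, add_comm _ _⟩

end IsKroneckerBasis

end Count

/-! ### Power sums, the count and the conclusion -/

section Main

open Module

variable {k : Type u} [Field k]

/-- The weighted power sums `∑ cₐ wₐ tₐᵖ`. -/
def powerSum {n : ℕ} (t w c : Fin n → k) (p : ℕ) : k := ∑ a, c a * w a * t a ^ p

theorem powerSum_add {n : ℕ} (t w c d : Fin n → k) (p : ℕ) :
    powerSum t w (c + d) p = powerSum t w c p + powerSum t w d p := by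
  simp only [powerSum, ← Finset.sum_add_distrib, Pi.add_apply, add_mul]

theorem eq_zero_of_powerSum_eq_zero {n : ℕ} {t w c : Fin n → k} (ht : Function.Injective t)
    (hw : ∀ a, w a ≠ 0) (h : ∀ p < n, powerSum t w c p = 0) : c = 0 := by
  have := Matrix.eq_zero_of_forall_pow_sum_mul_pow_eq_zero (v := fun a => c a * w a) ht
    fun i => h i i.2
  ext a
  exact (mul_eq_zero.1 (congrFun this a)).resolve_right (hw a)

theorem exists_powerSum_eq {n : ℕ} {t w : Fin n → k} (ht : Function.Injective t)
    (hw : ∀ a, w a ≠ 0) (D : ℕ → k) : ∃ c, ∀ p < n, powerSum t w c p = D p := by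
  let T : (Fin n → k) →ₗ[k] (Fin n → k) :=
    { toFun := fun c p => powerSum t w c p
      map_add' := fun c d => funext fun p => powerSum_add t w c d p
      map_smul' := fun r c => funext fun p => by
        simp [powerSum, Finset.mul_sum, mul_assoc] }
  have hT : Function.Injective T := by
    rw [← LinearMap.ker_eq_bot, Submodule.eq_bot_iff]
    intro c hc
    exact eq_zero_of_powerSum_eq_zero ht hw fun p hp => congrFun (LinearMap.mem_ker.1 hc) ⟨p, hp⟩
  obtain ⟨c, hc⟩ := LinearMap.injective_iff_surjective.1 hT fun p => D p
  exact ⟨c, fun p hp => congrFun hc ⟨p, hp⟩⟩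

variable {E : Type v} [AddCommGroup E] [Module k E]

namespace IsKroneckerBasis

variable {q₀ q₁ : QuadraticForm k E} {m : ℕ} {v : Fin (m + 1) → E} {u : Fin m → E}

theorem sum_powerSum_smul {n : ℕ} (t w c : Fin n → k) (j : ℕ) :
    ∑ i : Fin (m + 1), powerSum t w c (j + i) • v i =
      ∑ a, (c a * w a * t a ^ j) • ratVec v (t a) := by
  simp only [powerSum, ratVec, Finset.sum_smul, Finset.smul_sum, smul_smul]
  rw [Finset.sum_comm]
  simp only [pow_add, mul_assoc]

variable (K : IsKroneckerBasis q₀.polarBilin q₁.polarBilin v u)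
include K

/-- The added vector is `∑ cₐ wₐ tₐʲ r(tₐ)`, and `q₁`, `q₀` take the values `1 / wₐ`, `tₐ / wₐ` at
`r(tₐ)`. This produces the `c²` term, while pairing with `uⱼ` produces the linear one. -/
theorem map_add_sum_powerSum [CharP k 2] {n : ℕ} {t w : Fin n → k}
    (ht : ∀ a, q₀ (ratVec v (t a)) + t a * q₁ (ratVec v (t a)) = 0)
    (hw : ∀ a, w a * q₁ (ratVec v (t a)) = 1) (c : Fin n → k) (j : Fin m) :
    q₀ (u j + ∑ i : Fin (m + 1), powerSum t w c (j + i) • v i) =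
      q₀ (u j) + powerSum t w (c ^ 2 + c) (2 * j + 1) ∧
    q₁ (u j + ∑ i : Fin (m + 1), powerSum t w c (j + i) • v i) =
      q₁ (u j) + powerSum t w (c ^ 2 + c) (2 * j) := by
  have hmem (a) : ratVec v (t a) ∈ Submodule.span k (Set.range v) :=
    (Submodule.mem_span_range_iff_exists_fun k).2 ⟨_, rfl⟩
  have hpol := K.polar_u_sum j fun i => powerSum t w c (j + i)
  have h0 : q₀ (∑ i : Fin (m + 1), powerSum t w c (j + i) • v i) =
      powerSum t w (c ^ 2) (2 * j + 1) := by
    rw [sum_powerSum_smul, map_sum_of_polar_eq_zero q₀ _ _ fun a b =>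
      (K.polar_eq_zero_of_mem (hmem a) (hmem b)).1]
    refine Finset.sum_congr rfl fun a _ => ?_
    have h : q₀ (ratVec v (t a)) = t a * q₁ (ratVec v (t a)) := by
      rw [eq_neg_of_add_eq_zero_left (ht a), CharTwo.neg_eq]
    rw [h, Pi.pow_apply]
    linear_combination (c a ^ 2 * w a * t a ^ (2 * (j : ℕ) + 1)) * hw a
  have h1 : q₁ (∑ i : Fin (m + 1), powerSum t w c (j + i) • v i) =
      powerSum t w (c ^ 2) (2 * j) := by
    rw [sum_powerSum_smul, map_sum_of_polar_eq_zero q₁ _ _ fun a b =>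
      (K.polar_eq_zero_of_mem (hmem a) (hmem b)).2]
    refine Finset.sum_congr rfl fun a _ => ?_
    rw [Pi.pow_apply]
    linear_combination (c a ^ 2 * w a * t a ^ (2 * (j : ℕ))) * hw a
  rw [QuadraticMap.map_add q₀, QuadraticMap.map_add q₁, hpol.1, hpol.2, h0, h1, powerSum_add,
    powerSum_add, Fin.val_succ, Fin.val_castSucc, add_assoc, add_assoc, ← add_assoc (j : ℕ) j 1,
    ← two_mul]
  exact ⟨rfl, rfl⟩

/-- Every `m`-dimensional subspace of `X` is spanned by vectors `uⱼ + ∑ᵢ H (j + i) vᵢ`. -/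
theorem exists_hankel_mem [IsAlgClosed k] [CharP k 2] [FiniteDimensional k E]
    (h : IsNonsingular q₀ q₁) (hE : finrank k E = 2 * m + 1) {L : Submodule k E}
    (hL : IsContained q₀ q₁ L) (hLm : finrank k L = m) :
    ∃ H : ℕ → k, ∀ j : Fin m, u j + ∑ i : Fin (m + 1), H (j + i) • v i ∈ L := by
  have hc := K.isCompl h hE hL hLm
  have hex (j : Fin m) : ∃ c : Fin (m + 1) → k, u j + ∑ i, c i • v i ∈ L := by
    have hu : u j ∈ Submodule.span k (Set.range v) ⊔ L := by rw [hc.sup_eq_top]; trivial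
    obtain ⟨a, ha, l, hl, hal⟩ := Submodule.mem_sup.1 hu
    obtain ⟨c, hc⟩ := (Submodule.mem_span_range_iff_exists_fun k).1 (neg_mem ha)
    refine ⟨c, ?_⟩
    rw [hc, ← hal]
    simpa using hl
  choose c hcL using hex
  have hrel (i j : Fin m) := hL.polar_eq_zero (hcL i) (hcL j)
  have hadd := fun i j => K.polar_add_add c i j
  let N : ℕ → ℕ → k := fun i j =>
    if h : i < m ∧ j < m + 1 then c ⟨i, h.1⟩ ⟨j, h.2⟩ else 0
  have hN {i j : ℕ} (hi : i < m) (hj : j < m + 1) : N i j = c ⟨i, hi⟩ ⟨j, hj⟩ :=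
    dif_pos ⟨hi, hj⟩
  obtain ⟨H, hH⟩ := exists_hankel (N := N) (m := m)
    (fun i hi j hj => by
      rw [hN hi (by omega), hN hj (by omega)]
      have e := (hadd ⟨i, hi⟩ ⟨j, hj⟩).2.symm.trans (hrel _ _).2
      have e' := eq_neg_of_add_eq_zero_right e
      rw [CharTwo.neg_eq] at e'
      exact e')
    (fun i hi j hj => by
      rw [hN hi (by omega), hN hj (by omega)]
      have e := (hadd ⟨i, hi⟩ ⟨j, hj⟩).1.symm.trans (hrel _ _).1
      have e' := eq_neg_of_add_eq_zero_right e
      rw [CharTwo.neg_eq] at e'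
      exact e')
  refine ⟨H, fun j => ?_⟩
  have := hcL j
  convert this using 4 with i
  rw [← hH j j.2 i (Nat.lt_succ_iff.1 i.2), hN j.2 i.2]

theorem natCard_contained [IsAlgClosed k] [CharP k 2] [FiniteDimensional k E]
    (h : IsNonsingular q₀ q₁) (hE : finrank k E = 2 * m + 1) :
    Nat.card {L : Submodule k E // IsContained q₀ q₁ L ∧ finrank k L = m} = 2 ^ (2 * m) := by
  obtain ⟨t, htinj, ht⟩ := K.exists_roots h
  set w : Fin (2 * m) → k := fun a => (q₁ (ratVec v (t a)))⁻¹ with hwdef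
  have hq₁ (a) : q₁ (ratVec v (t a)) ≠ 0 := K.map_ratVec_ne_zero h _ (ht a)
  have hw0 (a) : w a ≠ 0 := inv_ne_zero (hq₁ a)
  have hw (a) : w a * q₁ (ratVec v (t a)) = 1 := inv_mul_cancel₀ (hq₁ a)
  -- The values of `q₁` and `q₀` at the `uⱼ` become the even and odd power sums of `e`.
  obtain ⟨e, he⟩ := exists_powerSum_eq htinj hw0 fun p =>
    if hp : p / 2 < m then (if p % 2 = 0 then q₁ (u ⟨p / 2, hp⟩) else q₀ (u ⟨p / 2, hp⟩)) else 0
  have he1 (j : Fin m) : powerSum t w e (2 * j) = q₁ (u j) := by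
    have h2 : 2 * (j : ℕ) % 2 = 0 := by omega
    rw [he _ (by omega)]
    simp [h2]
  have he0 (j : Fin m) : powerSum t w e (2 * j + 1) = q₀ (u j) := by
    have h1 : (2 * (j : ℕ) + 1) / 2 = j := by omega
    have h2 : (2 * (j : ℕ) + 1) % 2 = 1 := by omega
    rw [he _ (by omega)]
    simp [h1, h2]
  let x : (Fin (2 * m) → k) → Fin m → E := fun c j =>
    ∑ i : Fin (m + 1), powerSum t w c (j + i) • v i
  have hxV (c j) : x c j ∈ Submodule.span k (Set.range v) :=
    (Submodule.mem_span_range_iff_exists_fun k).2 ⟨_, rfl⟩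
  have hq (c) (j : Fin m) : q₀ (u j + x c j) = powerSum t w (c ^ 2 + c + e) (2 * j + 1) ∧
      q₁ (u j + x c j) = powerSum t w (c ^ 2 + c + e) (2 * j) := by
    have := K.map_add_sum_powerSum ht hw c j
    rw [powerSum_add _ _ _ e, powerSum_add _ _ _ e, he0, he1, add_comm _ (q₀ (u j)),
      add_comm _ (q₁ (u j))]
    exact this
  let L : (Fin (2 * m) → k) → Submodule k E := fun c =>
    Submodule.span k (Set.range fun j => u j + x c j)
  have hdim (c) : finrank k (L c) = m := K.finrank_span_add (hxV c)
  have hcont (c : Fin (2 * m) → k) (hc : ∀ a, c a ^ 2 + c a + e a = 0) :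
      IsContained q₀ q₁ (L c) := by
    have hc' : c ^ 2 + c + e = 0 := funext hc
    refine isContained_span (fun j => ?_) fun i j => ?_
    · rw [(hq c j).1, (hq c j).2, hc']
      simp [powerSum]
    · have := K.polar_add_add (fun (j : Fin m) (i : Fin (m + 1)) => powerSum t w c (j + i)) i j
      refine ⟨this.1.trans ?_, this.2.trans ?_⟩
      · rw [Fin.val_succ, Fin.val_succ, add_left_comm, ← add_assoc,
          CharTwo.add_self_eq_zero]
      · rw [Fin.val_castSucc, Fin.val_castSucc, add_comm (j : ℕ) i, CharTwo.add_self_eq_zero]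
  have hS := natCard_artinSchreier e
  rw [Fintype.card_fin] at hS
  rw [← hS]
  refine (Nat.card_congr (Equiv.ofBijective
    (fun c : {c : Fin (2 * m) → k // ∀ a, c a ^ 2 + c a + e a = 0} =>
      (⟨L c.1, hcont c.1 c.2, hdim c.1⟩ :
        {L : Submodule k E // IsContained q₀ q₁ L ∧ finrank k L = m})) ⟨?_, ?_⟩)).symm
  · rintro ⟨c, hc⟩ ⟨c', hc'⟩ hcc
    have hLL : L c = L c' := congrArg Subtype.val hcc
    have hx (j) : x c j = x c' j := by
      have h1 : u j + x c j ∈ L c := Submodule.subset_span ⟨j, rfl⟩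
      have h2 : u j + x c' j ∈ L c := by rw [hLL]; exact Submodule.subset_span ⟨j, rfl⟩
      have h3 := sub_mem h1 h2
      rw [add_sub_add_left_eq_sub] at h3
      have h4 := (K.isCompl h hE (hcont c hc) (hdim c)).disjoint.le_bot
        ⟨sub_mem (hxV c j) (hxV c' j), h3⟩
      exact sub_eq_zero.1 h4
    have hps : ∀ (j : Fin m) (i : Fin (m + 1)),
        powerSum t w c (j + i) = powerSum t w c' (j + i) := fun j i =>
      Fintype.linearIndependent_iffₛ.1 K.linearIndependent _ _ (hx j) i
    refine Subtype.ext (sub_eq_zero.1 (eq_zero_of_powerSum_eq_zero htinj hw0 fun p hp => ?_))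
    have hsub : powerSum t w c p = powerSum t w (c - c') p + powerSum t w c' p := by
      rw [← powerSum_add, sub_add_cancel]
    have : powerSum t w c p = powerSum t w c' p := by
      -- Entry `p` stands in the first column if `p < m`, else in the last column at row `p - m`.
      by_cases hpm : p < m
      · exact hps ⟨p, hpm⟩ 0
      · have := hps ⟨p - m, by omega⟩ (Fin.last m)
        simpa [Nat.sub_add_cancel (not_lt.1 hpm)] using this
    rw [this] at hsub
    exact left_eq_add.1 (by rw [add_comm]; exact hsub)
  · rintro ⟨M, hM, hMm⟩
    obtain ⟨H, hH⟩ := K.exists_hankel_mem h hE hM hMm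
    obtain ⟨c, hc⟩ := exists_powerSum_eq htinj hw0 H
    have hmem (j) : u j + x c j ∈ M := by
      have : x c j = ∑ i : Fin (m + 1), H (j + i) • v i :=
        Finset.sum_congr rfl fun i _ => by rw [hc _ (by omega)]
      rw [this]
      exact hH j
    have hLM : L c = M := by
      refine Submodule.eq_of_le_of_finrank_eq (Submodule.span_le.2 ?_) ((hdim c).trans hMm.symm)
      rintro _ ⟨j, rfl⟩
      exact hmem j
    have hzero : c ^ 2 + c + e = 0 := by
      refine eq_zero_of_powerSum_eq_zero htinj hw0 fun p hp => ?_
      have hj := hq c ⟨p / 2, by omega⟩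
      have hMj := hM _ (hmem ⟨p / 2, by omega⟩)
      rw [hj.1, hj.2] at hMj
      rcases Nat.even_or_odd' p with ⟨r, rfl | rfl⟩
      · simpa using hMj.2
      · have hr : (2 * r + 1) / 2 = r := by omega
        simpa [hr] using hMj.1
    exact ⟨⟨c, congrFun hzero⟩, Subtype.ext hLM⟩

end IsKroneckerBasis

theorem IsNonsingular.exists_isKroneckerBasis [IsAlgClosed k] [CharP k 2] [FiniteDimensional k E]
    {q₀ q₁ : QuadraticForm k E} (h : IsNonsingular q₀ q₁) {m : ℕ}
    (hE : finrank k E = 2 * m + 1) : ∃ (v : Fin (m + 1) → E) (u : Fin m → E),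
      IsKroneckerBasis q₀.polarBilin q₁.polarBilin v u :=
  QuadricPair.exists_isKroneckerBasis (isAlt_polarBilin q₀) (isAlt_polarBilin q₁)
    (fun _ _ hst => h.finrank_ker ⟨m, hE⟩ hst) hE

theorem IsRegular.isNonsingular [FiniteDimensional k E] {q₀ q₁ : QuadraticForm k E}
    (h : IsRegular q₀ q₁) : IsNonsingular q₀ q₁ :=
  fun _ hx h0 h1 _ _ hst => h.exists_polar_ne_zero hx h0 h1 hst

end Main

end QuadricPair

theorem mainTheorem9 {k : Type u} [Field k] [IsAlgClosed k] [CharP k 2]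
    {E : Type v} [AddCommGroup E] [Module k E] [FiniteDimensional k E]
    (m : ℕ) (hm : 1 ≤ m) (hE : Module.finrank k E = 2 * m + 1)
    (q₀ q₁ : QuadraticForm k E) (hq : QuadricPair.IsRegular q₀ q₁) :
    (∀ L : Submodule k E, QuadricPair.IsGenerator q₀ q₁ L ↔
        (QuadricPair.IsContained q₀ q₁ L ∧ Module.finrank k L = m)) ∧
      Nat.card (QuadricPair.Generator q₀ q₁) = 2 ^ (2 * m) ∧
      ∀ Λ Λ' : QuadricPair.Generator q₀ q₁, ∃! g : QuadricPair.Aut q₀ q₁, g • Λ = Λ' := by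
  have hns := hq.isNonsingular
  obtain ⟨v, u, K⟩ := hns.exists_isKroneckerBasis hE
  have hcard := K.natCard_contained hns hE
  -- The nonzero count shows that the upper bound `m` on dimensions is attained.
  obtain ⟨L₀, hL₀, hL₀m⟩ : ∃ L : Submodule k E,
      QuadricPair.IsContained q₀ q₁ L ∧ Module.finrank k L = m := by
    have : Nat.card {L : Submodule k E // QuadricPair.IsContained q₀ q₁ L ∧
        Module.finrank k L = m} ≠ 0 := by rw [hcard]; positivity
    obtain ⟨⟨L, hL⟩⟩ := (Nat.card_ne_zero.1 this).1
    exact ⟨L, hL⟩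
  have hgen : ∀ L : Submodule k E, QuadricPair.IsGenerator q₀ q₁ L ↔
      (QuadricPair.IsContained q₀ q₁ L ∧ Module.finrank k L = m) := fun L =>
    ⟨fun hL => ⟨hL.1, le_antisymm (hL.1.finrank_le hns hE) (hL₀m ▸ hL.2 L₀ hL₀)⟩,
      fun hL => ⟨hL.1, fun L' hL' => hL.2 ▸ hL'.finrank_le hns hE⟩⟩
  refine ⟨hgen, ?_, fun Λ Λ' => ?_⟩
  · rw [← hcard]
    exact Nat.card_congr (Equiv.subtypeEquivRight hgen)
  · obtain ⟨hΛ, hΛm⟩ := (hgen _).1 Λ.2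
    obtain ⟨hΛ', hΛm'⟩ := (hgen _).1 Λ'.2
    obtain ⟨g, hg⟩ := K.exists_aut hns hE hΛ hΛm hΛ' hΛm'
    refine ⟨g, Subtype.ext ?_, fun g' hg' => ?_⟩
    · change Λ.1.map (g : E ≃ₗ[k] E).toLinearMap = Λ'.1
      refine Submodule.eq_of_le_of_finrank_eq (Submodule.map_le_iff_le_comap.2 hg) ?_
      rw [LinearEquiv.finrank_map_eq, hΛm, hΛm']
    · refine K.aut_unique hns hE hΛ hΛm hΛ' hΛm' (fun x hx => ?_) hg
      have : Λ.1.map (g' : E ≃ₗ[k] E).toLinearMap = Λ'.1 := congrArg Subtype.val hg'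
      rw [← this]
      exact ⟨x, hx, rfl⟩
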